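/- Consider Bernoulli bond percolation on the square lattice $\mathbb{Z}^2$ (the graph with vertex set $\mathbb{Z}^2$ in which two vertices are adjacent when their $\ell^1$-distance is $1$): each edge is declared open with probability $p\in[0,1]$ and closed with probability $1-p$, independently of the other edges. Let $\mathbb{P}_p$ be the law of the resulting configuration. For a vertex $x$ and a set of vertices $A$, write $x\leftrightarrow A$ if $x$ is joined to some vertex of $A$ by a (possibly trivial) path of open edges. Let $\theta(p)$ be the $\mathbb{P}_p$-probability that the connected component of $0$ in the graph of open edges is infinite, and let \[ p_c := \sup\{p\in(0,1) : \theta(p)=0\}. \] For $n\ge 1$ let $\Lambda_n := \{-n,\dots,n\}^2$, and let $\partial\Lambda_n$ be the set of vertices of $\Lambda_n$ that have a neighbour in $\mathbb{Z}^2$ outside $\Lambda_n$. Then $p_c = \tfrac12$. Moreover, there exists $\alpha>0$ such that \[ \tfrac12\, n^{-1} \;\le\; \mathbb{P}_{1/2}\bigl[0\leftrightarrow\partial\Lambda_n\bigr] \;\le\; n^{-\alpha} \qquad\text{for all integers } n\ge 1. \] In particular, $\theta(p_c)=0$. -/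

import Mathlib

open MeasureTheory ProbabilityTheory
open scoped unitInterval

namespace Percolation

section General

variable {V : Type*}

/-- Percolation configurations on the graph `G`, i.e. elements of `{0,1}^E`. An edge `e` is open
if `ω e = true` and closed otherwise. -/
abbrev Config (G : SimpleGraph V) : Type _ := G.edgeSet → Bool

/-- The law `ℙ_p` of Bernoulli bond percolation on `G`: the states of the edges are independent,
and each edge is open with probability `p` and closed with probability `1 - p`. -/
noncomputable def law (G : SimpleGraph V) (p : I) : Measure (Config G) :=
  Measure.infinitePi fun _ : G.edgeSet => bernoulliMeasure true false p

/-- The configuration `ω`, seen as the subgraph of `G` with all the vertices of `G` and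
the open edges. -/
def openGraph {G : SimpleGraph V} (ω : Config G) : SimpleGraph V where
  Adj x y := ∃ h : s(x, y) ∈ G.edgeSet, ω ⟨s(x, y), h⟩ = true
  symm := ⟨fun x y ⟨h, hω⟩ => by
    have e : s(y, x) = s(x, y) := Sym2.eq_swap
    exact ⟨e ▸ h, by simpa only [e] using hω⟩⟩
  loopless := ⟨fun x ⟨h, _⟩ => G.loopless.irrefl x h⟩

/-- `x` is connected to some vertex of `A` by a path of open edges. -/
def ConnectedTo {G : SimpleGraph V} (ω : Config G) (x : V) (A : Set V) : Prop :=
  ∃ y ∈ A, (openGraph ω).Reachable x y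

/-- The cluster of `x`: its connected component in the configuration `ω`. -/
def cluster {G : SimpleGraph V} (ω : Config G) (x : V) : Set V :=
  {y | (openGraph ω).Reachable x y}

end General

/-- The square lattice `ℤ²`: two points are adjacent if they are at `ℓ¹`-distance one. -/
def squareLattice : SimpleGraph (ℤ × ℤ) where
  Adj x y := |x.1 - y.1| + |x.2 - y.2| = 1
  symm := ⟨fun x y h => by rwa [abs_sub_comm y.1 x.1, abs_sub_comm y.2 x.2]⟩
  loopless := ⟨fun x h => by simp at h⟩

/-- The box `Λ_n = {-n, …, n}²`. -/
def box (n : ℕ) : Set (ℤ × ℤ) := {x | |x.1| ≤ n ∧ |x.2| ≤ n}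

/-- `∂Λ_n`: the vertices of `Λ_n` that have a neighbour outside `Λ_n`. -/
def boxBoundary (n : ℕ) : Set (ℤ × ℤ) :=
  {x | x ∈ box n ∧ ∃ y, squareLattice.Adj x y ∧ y ∉ box n}

/-- The one-arm probability `ℙ_p[0 ↔ ∂Λ_n]` on `ℤ²`. -/
noncomputable def oneArm (p : I) (n : ℕ) : ℝ :=
  (law squareLattice p).real {ω | ConnectedTo ω 0 (boxBoundary n)}

/-- `θ(p)`: the probability that the cluster of the origin of `ℤ²` is infinite. -/
noncomputable def theta (p : I) : ℝ :=
  (law squareLattice p).real {ω | (cluster ω 0).Infinite}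

/-- The critical point `p_c = sup {p ∈ (0,1) : θ(p) = 0}` of Bernoulli percolation on `ℤ²`,
as an element of `[0,1]`. -/
noncomputable def criticalPoint : I :=
  sSup {p : I | 0 < p ∧ p < 1 ∧ theta p = 0}

/-- The parameter `1/2`, as an element of `[0,1]`. -/
noncomputable def half : I := ⟨1 / 2, by norm_num, by norm_num⟩

end Percolation

/-!
The proof works at the self-dual point `1/2` with planar duality, and above it with a differential
inequality. Edges are encoded as `Edge = (ℤ × ℤ) × Bool`; a face of the lattice is encoded by its
lower left corner, so that the dual lattice is again `ℤ × ℤ`, and `crossed` sends a dual edge to the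
primal edge it crosses.

*Planar topology.* Everything rests on the discrete Poincaré lemma `exists_coloring_of_cycle`: a
1-cycle modulo 2 of the lattice is the interface of a two-colouring of the faces. Prolonging a
horizontal crossing of a rectangle by two half-lines gives a cycle, and the colouring shows that the
crossing meets every vertical path (`exists_common_vertex`) and excludes a vertical dual crossing by
closed edges (`not_hcross_and_dual_vcross`). Conversely, explore from the left of a rectangle the
faces accessible through closed edges. If the right side is not reached, the interface between the
explored set, with its holes filled, and the rest is made of open edges; it is connected because
any of its connected components is a cycle, whose colouring must be the given one
(`conn_interface`). Hence there is an open vertical crossing (`vcross_of_explored`), and by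
self-duality the `(m + 2) × (m + 1)` rectangle is crossed the long way with probability at least
`1/2` (`half_le_crossProb_add_one`). A union bound over the left side gives
`half_div_le_armProb`, the lower bound on the one-arm probability.

*Russo–Seymour–Welsh.* Condition on the explored set in the lower left quarter of a square and
reflect it in the horizontal axis of the square. The unexplored edges are still independent, and a
horizontal crossing of the square arrives at the symmetrized interface; by symmetry it arrives at
its lower half with conditional probability at least `1/4`, and is then connected to a vertical
crossing of the quarter (`prob_crossAndArm`). Two mirror images of this event and Harris' inequality
give crossings of `3 : 2` rectangles, and then of all rectangles of fixed shape
(`crossProb_long`). In each annulus, with probability bounded below, four dual crossings separate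
the inside from the outside; independence over scales gives the polynomial upper bound
`exists_armProb_le_rpow`, hence `θ(1/2) = 0`.

*Above `1/2`.* Following Duminil-Copin and Tassion, let `flux p S` be the expected number of
boundary edges of the finite set `S` whose inner endpoint is joined to the origin inside `S`.
Simon's inequality `armProb_le_flux` shows that a set with `flux (1/2) S < 2` would force
exponential decay of the one-arm probability at `1/2`, against the lower bound. So all fluxes are at
least `2` for `p ≥ 1/2`, and Russo's formula, conditioned on the set connected to the boundary of
the box, gives `θ_n' ≥ 1 - θ_n` for the one-arm probability `θ_n`
(`one_sub_armProb_le_sum_pivotal`). Integration yields `θ_n(p) ≥ 1 - exp (1/2 - p)` for all `n`,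
so that `θ(p) > 0` for every `p > 1/2`.
-/

namespace Percolation

/-! ### Finite-range events under the Bernoulli product measure -/

section Bernoulli

variable {E : Type*} {E' : Type*} {p : I} {A B : Set (E → Bool)}

/-- The law of a family of independent coins indexed by `E`, each equal to `true` with
probability `p`. -/
noncomputable def bern (E : Type*) (p : I) : Measure (E → Bool) :=
  Measure.infinitePi fun _ : E => bernoulliMeasure true false p

instance : IsProbabilityMeasure (bern E p) := by
  unfold bern; infer_instance

/-- Relabelling the coins by an equivalence of the index sets. -/
def relabel (f : E' ≃ E) : (E → Bool) ≃ᵐ (E' → Bool) where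
  toFun ω i := ω (f i)
  invFun ω i := ω (f.symm i)
  left_inv ω := by simp
  right_inv ω := by simp
  measurable_toFun := by
    simp only [Equiv.coe_fn_mk]
    fun_prop
  measurable_invFun := by
    simp only [Equiv.coe_fn_symm_mk]
    fun_prop

/-- Exchanging the two values of each coin. -/
def flipAll (E : Type*) : (E → Bool) ≃ᵐ (E → Bool) where
  toFun ω i := !ω i
  invFun ω i := !ω i
  left_inv ω := by simp
  right_inv ω := by simp
  measurable_toFun := by
    simp only [Equiv.coe_fn_mk]
    exact measurable_pi_lambda _ fun i => (measurable_of_finite not).comp (measurable_pi_apply i)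
  measurable_invFun := by
    simp only [Equiv.coe_fn_symm_mk]
    exact measurable_pi_lambda _ fun i => (measurable_of_finite not).comp (measurable_pi_apply i)

theorem measurePreserving_relabel (p : I) (f : E' ≃ E) :
    MeasurePreserving (relabel f) (bern E p) (bern E' p) :=
  ⟨(relabel f).measurable, Measure.map_infinitePi_infinitePi_of_inj
    (P := fun _ : E => bernoulliMeasure true false p) f.injective⟩

theorem bern_real_relabel (p : I) (f : E' ≃ E) (P : (E' → Bool) → Prop) :
    (bern E p).real {ω | P fun i => ω (f i)} = (bern E' p).real {ω | P ω} :=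
  congrArg ENNReal.toReal ((measurePreserving_relabel p f).measure_preimage_equiv {ω | P ω})

theorem measurePreserving_flipAll :
    MeasurePreserving (flipAll E) (bern E half) (bern E half) := by
  refine ⟨(flipAll E).measurable, ?_⟩
  have h := Measure.infinitePi_map_pi (μ := fun _ : E => bernoulliMeasure true false half)
    (f := fun _ => not) (fun _ => measurable_of_finite _)
  have hb : (bernoulliMeasure true false half).map not = bernoulliMeasure true false half := by
    rw [map_bernoulliMeasure' _ _ (measurable_of_finite _)]
    have : half = unitInterval.symm half := by
      apply Subtype.ext
      simp only [half, unitInterval.coe_symm_eq]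
      norm_num
    ext s hs
    classical
    rw [bernoulliMeasure_apply _ hs, bernoulliMeasure_apply _ hs, ← this]
    simp only [Bool.not_true, Bool.not_false]
    split_ifs <;> rfl
  simp only [hb] at h
  exact h

theorem bern_real_flipAll (P : (E → Bool) → Prop) :
    (bern E half).real {ω | P fun i => !ω i} = (bern E half).real {ω | P ω} :=
  congrArg ENNReal.toReal (measurePreserving_flipAll.measure_preimage_equiv {ω | P ω})

/-- The weight of the value `b` for a coin of parameter `x`. -/
def wt (x : ℝ) (b : Bool) : ℝ := if b then x else 1 - x

theorem bernoulliMeasure_real_singleton (p : I) (b : Bool) :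
    (bernoulliMeasure true false p).real {b} = wt p b := by
  classical
  rw [bernoulliMeasure_real_apply p (measurableSet_singleton b)]
  cases b <;> simp [wt]

theorem wt_nonneg (p : I) (b : Bool) : 0 ≤ wt p b := by
  rw [← bernoulliMeasure_real_singleton]; exact measureReal_nonneg

open Classical in
/-- The configuration that agrees with `s` on `F` and is `false` off `F`. -/
noncomputable def extend (F : Finset E) (s : F → Bool) : E → Bool :=
  fun i => if h : i ∈ F then s ⟨i, h⟩ else false

theorem extend_restrict_mem {F : Finset E} (hA : DependsOn (· ∈ A) (F : Set E)) (ω : E → Bool) :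
    extend F (F.restrict ω) ∈ A ↔ ω ∈ A := by
  refine iff_of_eq (hA fun i hi => ?_)
  have : i ∈ F := hi
  simp [extend, this]

theorem preimage_restrict {F : Finset E} (hA : DependsOn (· ∈ A) (F : Set E)) :
    F.restrict ⁻¹' {s : F → Bool | extend F s ∈ A} = A :=
  Set.ext fun ω => extend_restrict_mem hA ω

theorem measurableSet_of_dependsOn {F : Set E} (hF : F.Finite) (hA : DependsOn (· ∈ A) F) :
    MeasurableSet A := by
  rw [← hF.coe_toFinset] at hA
  rw [← preimage_restrict hA]
  exact Finset.measurable_restrict _ (Set.toFinite _).measurableSet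

open Classical in
theorem bern_real_eq_sum {F : Finset E} (hA : DependsOn (· ∈ A) (F : Set E)) (p : I) :
    (bern E p).real A =
      ∑ s : F → Bool, (∏ i, wt p (s i)) * if extend F s ∈ A then 1 else 0 := by
  have h1 : (bern E p).real A
      = (Measure.pi fun _ : F => bernoulliMeasure true false p).real {s | extend F s ∈ A} := by
    have : (bern E p).map F.restrict = Measure.pi fun _ : F => bernoulliMeasure true false p :=
      Measure.infinitePi_map_restrict fun _ : E => bernoulliMeasure true false p
    rw [← this, map_measureReal_apply (Finset.measurable_restrict _)
      (Set.toFinite _).measurableSet, preimage_restrict hA]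
  rw [h1]
  have h2 : {s : F → Bool | extend F s ∈ A}
      = ((Finset.univ.filter fun s : F → Bool => extend F s ∈ A : Finset _) : Set _) := by
    ext; simp
  rw [h2, ← sum_measureReal_singleton, Finset.sum_filter]
  refine Finset.sum_congr rfl fun s _ => ?_
  have h3 : (Measure.pi fun _ : F => bernoulliMeasure true false p).real {s}
      = ∏ i, wt p (s i) := by
    rw [measureReal_def, Measure.pi_singleton, ENNReal.toReal_prod]
    exact Finset.prod_congr rfl fun i _ => bernoulliMeasure_real_singleton p (s i)
  split_ifs <;> simp [h3]

theorem bern_real_inter_of_disjoint {F G : Set E} (hF : F.Finite) (hG : G.Finite)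
    (hFG : Disjoint F G) (hA : DependsOn (· ∈ A) F) (hB : DependsOn (· ∈ B) G) :
    (bern E p).real (A ∩ B) = (bern E p).real A * (bern E p).real B := by
  have hi : iIndepFun (fun i (ω : E → Bool) => ω i) (bern E p) :=
    iIndepFun_infinitePi (X := fun _ x => x) (by fun_prop)
  have hd : Disjoint hF.toFinset hG.toFinset := by
    rwa [← Finset.disjoint_coe, hF.coe_toFinset, hG.coe_toFinset]
  have h := hi.indepFun_finset hF.toFinset hG.toFinset hd (by fun_prop)
  rw [← hF.coe_toFinset] at hA
  rw [← hG.coe_toFinset] at hB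
  rw [← preimage_restrict hA, ← preimage_restrict hB]
  have := h.measure_inter_preimage_eq_mul {s | extend _ s ∈ A} {s | extend _ s ∈ B}
    (Set.toFinite _).measurableSet (Set.toFinite _).measurableSet
  exact (congrArg ENNReal.toReal this).trans ENNReal.toReal_mul

theorem extend_mono (F : Finset E) : Monotone (extend F) := by
  intro s t h i
  by_cases hi : i ∈ F
  · simpa [extend, hi] using h ⟨i, hi⟩
  · simp [extend, hi]

/-- Harris' inequality for increasing events. -/
theorem harris {F : Set E} (hF : F.Finite) (hA : DependsOn (· ∈ A) F)
    (hB : DependsOn (· ∈ B) F) (iA : IsUpperSet A) (iB : IsUpperSet B) :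
    (bern E p).real A * (bern E p).real B ≤ (bern E p).real (A ∩ B) := by
  classical
  rw [← hF.coe_toFinset] at hA hB
  set G := hF.toFinset
  have hAB : DependsOn (· ∈ A ∩ B) (G : Set E) := fun x y h => by
    have h1 := hA h
    have h2 := hB h
    simp only [Set.mem_inter_iff] at *
    rw [h1, h2]
  have huniv : DependsOn (· ∈ (Set.univ : Set (E → Bool))) (G : Set E) := fun _ _ _ => by simp
  have h1 : ∑ s : G → Bool, ∏ i, wt (p : ℝ) (s i) = 1 := by
    have := bern_real_eq_sum huniv p
    simpa using this.symm
  rw [bern_real_eq_sum hA, bern_real_eq_sum hB, bern_real_eq_sum hAB]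
  have key := fkg (α := G → Bool) (μ := fun s => ∏ i, wt (p : ℝ) (s i))
    (f := fun s => if extend G s ∈ A then (1 : ℝ) else 0)
    (g := fun s => if extend G s ∈ B then (1 : ℝ) else 0)
    (fun s => Finset.prod_nonneg fun i _ => wt_nonneg p _)
    (fun s => by simp only [Pi.zero_apply]; split_ifs <;> norm_num)
    (fun s => by simp only [Pi.zero_apply]; split_ifs <;> norm_num)
    (fun s t h => by
      have := iA (extend_mono G h)
      simp only
      split_ifs <;> first | exact le_rfl | exact zero_le_one | exact absurd (this ‹_›) ‹_›)
    (fun s t h => by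
      have := iB (extend_mono G h)
      simp only
      split_ifs <;> first | exact le_rfl | exact zero_le_one | exact absurd (this ‹_›) ‹_›)
    (fun s t => by
      simp only [← Finset.prod_mul_distrib]
      refine le_of_eq (Finset.prod_congr rfl fun i _ => ?_)
      simp only [Pi.inf_apply, Pi.sup_apply]
      cases s i <;> cases t i <;> simp [mul_comm])
  rw [h1, one_mul] at key
  refine key.trans (le_of_eq (Finset.sum_congr rfl fun s _ => ?_))
  simp only [Set.mem_inter_iff]
  split_ifs <;> simp_all

theorem dependsOn_inter {F : Set E} (hA : DependsOn (· ∈ A) F) (hB : DependsOn (· ∈ B) F) :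
    DependsOn (· ∈ A ∩ B) F :=
  fun x y h => by
    have h1 := hA h
    have h2 := hB h
    simp only [Set.mem_inter_iff] at *
    rw [h1, h2]

/-- Harris' inequality for the complements of increasing events. -/
theorem harris_compl {F : Set E} (hF : F.Finite) (hA : DependsOn (· ∈ A) F)
    (hB : DependsOn (· ∈ B) F) (iA : IsUpperSet A) (iB : IsUpperSet B) :
    (1 - (bern E p).real A) * (1 - (bern E p).real B) ≤ 1 - (bern E p).real (A ∪ B) := by
  have h := harris (p := p) hF hA hB iA iB
  have h2 := measureReal_union_add_inter (μ := bern E p) (s := A)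
    (measurableSet_of_dependsOn hF hB)
  nlinarith

/-- Sum over the values of an explored quantity `T`: if the event `T = t` and the event `Y t` are
governed by disjoint sets of coins for every `t`, then, given `T = t`, the event `Y t` keeps its
unconditional probability. -/
theorem bern_real_decouple {τ : Type*} (T : (E → Bool) → τ) {F : Set E} (hF : F.Finite)
    (hT : DependsOn T F) (Q : τ → Prop) (G₁ : τ → Set E)
    (hT' : ∀ t, DependsOn (fun ω => T ω = t) (G₁ t ∩ F)) :
    ∃ R : Finset τ, (∀ t ∈ R, Q t) ∧
      (bern E p).real {ω | Q (T ω)} = ∑ t ∈ R, (bern E p).real {ω | T ω = t} ∧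
      ∀ (Y : τ → Set (E → Bool)) (G₂ : τ → Set E), (∀ t, Q t → (G₂ t).Finite) →
        (∀ t, Q t → Disjoint (G₁ t ∩ F) (G₂ t)) → (∀ t, Q t → DependsOn (· ∈ Y t) (G₂ t)) →
        (bern E p).real {ω | Q (T ω) ∧ ω ∈ Y (T ω)}
          = ∑ t ∈ R, (bern E p).real {ω | T ω = t} * (bern E p).real (Y t) := by
  classical
  have hfin : (Set.range T).Finite := by
    have hsub : Set.range T ⊆ Set.range fun s : hF.toFinset → Bool => T (extend hF.toFinset s) := by
      rintro _ ⟨ω, rfl⟩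
      refine ⟨hF.toFinset.restrict ω, hT fun i hi => ?_⟩
      simp [extend, hi]
    exact (Set.finite_range _).subset hsub
  have hR : ∀ t ∈ hfin.toFinset.filter Q, Q t := fun t ht => (Finset.mem_filter.1 ht).2
  have hFt : ∀ t, (G₁ t ∩ F).Finite := fun t => hF.subset Set.inter_subset_right
  refine ⟨hfin.toFinset.filter Q, hR, ?_, fun Y G₂ hG₂ hdisj hY => ?_⟩
  · rw [← measureReal_biUnion_finset]
    · congr 1
      ext ω
      simp
    · intro t _ t' _ htt
      exact Set.disjoint_left.2 fun ω (h : T ω = t) (h' : T ω = t') => htt (h.symm.trans h')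
    · exact fun t _ => measurableSet_of_dependsOn (hFt t) (hT' t)
  · have : ∀ t ∈ hfin.toFinset.filter Q, (bern E p).real {ω | T ω = t} * (bern E p).real (Y t)
        = (bern E p).real ({ω | T ω = t} ∩ Y t) := fun t ht =>
      (bern_real_inter_of_disjoint (hFt t) (hG₂ t (hR t ht)) (hdisj t (hR t ht)) (hT' t)
        (hY t (hR t ht))).symm
    rw [Finset.sum_congr rfl this, ← measureReal_biUnion_finset]
    · congr 1
      ext ω
      simp
    · intro t _ t' _ htt
      exact Set.disjoint_left.2 fun ω h h' => htt (h.1.symm.trans h'.1)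
    · exact fun t ht => (measurableSet_of_dependsOn (hFt t) (hT' t)).inter
        (measurableSet_of_dependsOn (hG₂ t (hR t ht)) (hY t (hR t ht)))

open Classical in
/-- The event that the coin `e` is pivotal for `A`. -/
def pivotal (A : Set (E → Bool)) (e : E) : Set (E → Bool) :=
  {ω | Function.update ω e true ∈ A ∧ Function.update ω e false ∉ A}

theorem mem_pivotal [DecidableEq E] {e : E} {ω : E → Bool} : ω ∈ pivotal A e ↔
    Function.update ω e true ∈ A ∧ Function.update ω e false ∉ A := by
  unfold pivotal
  rw [Set.mem_ofPred_eq]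
  congr!

open Classical in
theorem dependsOn_pivotal {F : Set E} (hA : DependsOn (· ∈ A) F) (e : E) :
    DependsOn (· ∈ pivotal A e) F := fun x y h => by
  have h1 : ∀ b, (Function.update x e b ∈ A) = (Function.update y e b ∈ A) := fun b =>
    hA fun i hi => by
      rcases eq_or_ne i e with rfl | hne
      · simp
      · simpa [hne] using h i hi
  simp only [pivotal, Set.mem_ofPred_eq, h1]

open Classical in
theorem extend_update {F : Finset E} (s : F → Bool) (i : F) (b : Bool) :
    extend F (Function.update s i b) = Function.update (extend F s) i b := by
  ext j
  rcases eq_or_ne j i with rfl | hne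
  · simp [extend]
  · by_cases hj : j ∈ F
    · have : (⟨j, hj⟩ : F) ≠ i := fun h => hne (congrArg Subtype.val h)
      simp [extend, hj, hne, this]
    · simp [extend, hj, hne]

open Classical in
/-- One term of Russo's formula. The configurations are grouped in pairs that differ only at the
coin `i`; the pair contributes the product of the other weights if `i` is pivotal, and nothing
otherwise. -/
theorem sum_sign_eq_sum_pivotal {F : Finset E} (iA : IsUpperSet A) (x : ℝ) (i : F) :
    ∑ s : F → Bool, (∏ j ∈ Finset.univ.erase i, wt x (s j)) * (if s i then (1 : ℝ) else -1) *
        (if extend F s ∈ A then 1 else 0) =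
      ∑ s : F → Bool, (∏ j, wt x (s j)) * if extend F s ∈ pivotal A i then 1 else 0 := by
  set f : (F → Bool) → ℝ := fun s => (∏ j ∈ Finset.univ.erase i, wt x (s j)) *
    (if s i then (1 : ℝ) else -1) * (if extend F s ∈ A then 1 else 0)
  set g : (F → Bool) → ℝ := fun s =>
    (∏ j, wt x (s j)) * if extend F s ∈ pivotal A i then 1 else 0
  let flip : (F → Bool) → (F → Bool) := fun s => Function.update s i (!s i)
  have hinv : Function.Involutive flip := fun s => by simp [flip]
  have hpair : ∀ s, f s + f (flip s) = g s + g (flip s) := by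
    intro s
    have hW : ∀ b, ∏ j ∈ Finset.univ.erase i, wt x (Function.update s i b j)
        = ∏ j ∈ Finset.univ.erase i, wt x (s j) := fun b =>
      Finset.prod_congr rfl fun j hj => by
        rw [Function.update_of_ne (Finset.ne_of_mem_erase hj)]
    have hf : ∀ b, f (Function.update s i b) = (∏ j ∈ Finset.univ.erase i, wt x (s j)) *
        (if b then (1 : ℝ) else -1) *
          (if Function.update (extend F s) i b ∈ A then 1 else 0) := fun b => by
      simp only [f, hW, extend_update, Function.update_self]
    have hg : ∀ b, g (Function.update s i b) =
        (wt x b * ∏ j ∈ Finset.univ.erase i, wt x (s j)) *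
          (if extend F s ∈ pivotal A i then 1 else 0) := fun b => by
      simp only [g]
      rw [← Finset.mul_prod_erase _ _ (Finset.mem_univ i), hW, extend_update]
      have hp : Function.update (extend F s) i b ∈ pivotal A i ↔ extend F s ∈ pivotal A i := by
        simp [pivotal]
      simp only [hp, Function.update_self]
    have hm : Function.update (extend F s) i false ∈ A → Function.update (extend F s) i true ∈ A :=
      fun h => iA (fun j => by
        rcases eq_or_ne j i with rfl | hne
        · simp
        · simp [hne]) h
    have hsum : f (Function.update s i true) + f (Function.update s i false)
        = g (Function.update s i true) + g (Function.update s i false) := by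
      rw [hf, hf, hg, hg]
      simp only [pivotal, Set.mem_ofPred_eq, wt]
      by_cases h1 : Function.update (extend F s) i true ∈ A <;>
        by_cases h0 : Function.update (extend F s) i false ∈ A
      · simp [h1, h0]
      · simp [h1, h0]; ring
      · exact absurd (hm h0) h1
      · simp [h1, h0]
    have hs : s = Function.update s i (s i) := by simp
    rcases hb : s i with _ | _
    · rw [hb] at hs
      have hfl : flip s = Function.update s i true := by simp [flip, hb]
      rw [hfl]
      conv_lhs => rw [hs]
      conv_rhs => rw [hs]
      simp only [Function.update_idem]
      linarith
    · rw [hb] at hs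
      have hfl : flip s = Function.update s i false := by simp [flip, hb]
      rw [hfl]
      conv_lhs => rw [hs]
      conv_rhs => rw [hs]
      simp only [Function.update_idem]
      linarith
  have hf2 : ∑ s, f (flip s) = ∑ s, f s := hinv.bijective.sum_comp f
  have hg2 : ∑ s, g (flip s) = ∑ s, g s := hinv.bijective.sum_comp g
  have := Finset.sum_congr (rfl : (Finset.univ : Finset (F → Bool)) = _) fun s _ => hpair s
  rw [Finset.sum_add_distrib, Finset.sum_add_distrib, hf2, hg2] at this
  linarith

/-- Russo's formula: the probability of an increasing event is a polynomial in the parameter,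
whose derivative is the expected number of pivotal coins. -/
theorem russo {F : Finset E} (hA : DependsOn (· ∈ A) (F : Set E)) (iA : IsUpperSet A) :
    ∃ f : ℝ → ℝ, (∀ p : I, f p = (bern E p).real A) ∧ Differentiable ℝ f ∧
      ∀ p : I, deriv f p = ∑ e ∈ F, (bern E p).real (pivotal A e) := by
  classical
  have hw : ∀ (x : ℝ) (b : Bool), HasDerivAt (fun x => wt x b) (if b then 1 else -1) x := by
    intro x b
    cases b
    · simpa [wt] using (hasDerivAt_id x).const_sub 1
    · simpa [wt] using hasDerivAt_id' x
  have hd : ∀ x : ℝ, HasDerivAt (fun x => ∑ s : F → Bool, (∏ i, wt x (s i)) *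
      if extend F s ∈ A then 1 else 0)
      (∑ e : F, ∑ s : F → Bool, (∏ j, wt x (s j)) *
        if extend F s ∈ pivotal A e then 1 else 0) x := by
    intro x
    simp only [← sum_sign_eq_sum_pivotal iA x]
    rw [Finset.sum_comm]
    refine HasDerivAt.fun_sum fun s _ => ?_
    rw [← Finset.sum_mul]
    refine HasDerivAt.mul_const ?_ _
    simpa only [smul_eq_mul] using
      HasDerivAt.fun_finsetProd (u := Finset.univ) fun i _ => hw x (s i)
  refine ⟨_, fun p => (bern_real_eq_sum hA p).symm, fun x => (hd x).differentiableAt,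
    fun p => ?_⟩
  rw [(hd p).deriv, ← Finset.sum_coe_sort F]
  exact Finset.sum_congr rfl fun e _ => (bern_real_eq_sum (dependsOn_pivotal hA _) p).symm

theorem bern_real_mono {F : Set E} (hF : F.Finite) (hA : DependsOn (· ∈ A) F)
    (iA : IsUpperSet A) {p q : I} (hpq : p ≤ q) : (bern E p).real A ≤ (bern E q).real A := by
  rw [← hF.coe_toFinset] at hA
  obtain ⟨f, hf, hdf, hf'⟩ := russo hA iA
  rw [← hf, ← hf]
  refine monotoneOn_of_deriv_nonneg (convex_Icc (0 : ℝ) 1) hdf.continuous.continuousOn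
    hdf.differentiableOn (fun x hx => ?_) p.2 q.2 hpq
  rw [interior_Icc] at hx
  have := hf' ⟨x, hx.1.le, hx.2.le⟩
  simp only at this
  rw [this]
  exact Finset.sum_nonneg fun _ _ => measureReal_nonneg

end Bernoulli

/-! ### Paths in the square lattice -/

/-- An edge of the square lattice, encoded by its lower or left endpoint and its direction:
`(z, false)` is the horizontal edge from `z` to `z + (1, 0)` and `(z, true)` the vertical edge from
`z` to `z + (0, 1)`. -/
abbrev Edge := (ℤ × ℤ) × Bool

/-- The left or lower endpoint of an edge. -/
def src (e : Edge) : ℤ × ℤ := e.1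

/-- The right or upper endpoint of an edge. -/
def tgt (e : Edge) : ℤ × ℤ := if e.2 then (e.1.1, e.1.2 + 1) else (e.1.1 + 1, e.1.2)

@[simp] theorem src_mk (z : ℤ × ℤ) (b : Bool) : src (z, b) = z := rfl
@[simp] theorem tgt_true (z : ℤ × ℤ) : tgt (z, true) = (z.1, z.2 + 1) := rfl
@[simp] theorem tgt_false (z : ℤ × ℤ) : tgt (z, false) = (z.1 + 1, z.2) := rfl

/-- `u` and `v` are the two endpoints of an edge of `O`. -/
def Step (O : Set Edge) (u v : ℤ × ℤ) : Prop :=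
  ∃ e ∈ O, (src e = u ∧ tgt e = v) ∨ (src e = v ∧ tgt e = u)

/-- `u` and `v` are joined by a path of edges of `O`. -/
def Conn (O : Set Edge) : ℤ × ℤ → ℤ × ℤ → Prop := Relation.ReflTransGen (Step O)

/-- The edges with both endpoints in `S`. -/
def inside (S : Set (ℤ × ℤ)) : Set Edge := {e | src e ∈ S ∧ tgt e ∈ S}

/-- The vertices joined to `s` by a path of edges of `O`. -/
def reach (O : Set Edge) (s : Set (ℤ × ℤ)) : Set (ℤ × ℤ) := {v | ∃ u ∈ s, Conn O u v}

/-- The open edges of a configuration. -/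
def opn (ω : Edge → Bool) : Set Edge := {e | ω e = true}

variable {O O' : Set Edge} {S S' : Set (ℤ × ℤ)} {u v w : ℤ × ℤ} {e : Edge}

theorem step_of_mem (h : e ∈ O) : Step O (src e) (tgt e) := ⟨e, h, Or.inl ⟨rfl, rfl⟩⟩

theorem Step.symm (h : Step O u v) : Step O v u := by
  obtain ⟨e, he, h⟩ := h
  exact ⟨e, he, h.symm⟩

theorem Step.mono (hO : O ⊆ O') (h : Step O u v) : Step O' u v := by
  obtain ⟨e, he, h⟩ := h
  exact ⟨e, hO he, h⟩

theorem step_iff : Step O u v ↔ (v = (u.1 + 1, u.2) ∧ (u, false) ∈ O) ∨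
    (u = (v.1 + 1, v.2) ∧ (v, false) ∈ O) ∨ (v = (u.1, u.2 + 1) ∧ (u, true) ∈ O) ∨
    (u = (v.1, v.2 + 1) ∧ (v, true) ∈ O) := by
  constructor
  · rintro ⟨⟨z, _ | _⟩, he, ⟨rfl, rfl⟩ | ⟨rfl, rfl⟩⟩ <;> simp [he]
  · rintro (⟨rfl, h⟩ | ⟨rfl, h⟩ | ⟨rfl, h⟩ | ⟨rfl, h⟩)
    · exact step_of_mem h
    · exact (step_of_mem h).symm
    · exact step_of_mem h
    · exact (step_of_mem h).symm

theorem Conn.refl : Conn O u u := Relation.ReflTransGen.refl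

theorem Conn.symm (h : Conn O u v) : Conn O v u := by
  induction h with
  | refl => exact Conn.refl
  | tail _ h ih => exact Relation.ReflTransGen.head h.symm ih

theorem Conn.trans (h : Conn O u v) (h' : Conn O v w) : Conn O u w :=
  Relation.ReflTransGen.trans h h'

theorem Step.conn (h : Step O u v) : Conn O u v := Relation.ReflTransGen.single h

theorem Conn.mono (hO : O ⊆ O') (h : Conn O u v) : Conn O' u v :=
  Relation.ReflTransGen.mono (fun _ _ => Step.mono hO) _ _ h

theorem inside_mono (h : S ⊆ S') : inside S ⊆ inside S' := fun _ he => ⟨h he.1, h he.2⟩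

theorem Step.inside (h : Step O u v) (hu : u ∈ S) (hv : v ∈ S) : Step (O ∩ inside S) u v := by
  obtain ⟨e, he, ⟨rfl, rfl⟩ | ⟨rfl, rfl⟩⟩ := h
  · exact ⟨e, ⟨he, hu, hv⟩, Or.inl ⟨rfl, rfl⟩⟩
  · exact ⟨e, ⟨he, hv, hu⟩, Or.inr ⟨rfl, rfl⟩⟩

theorem Step.mem_inside (h : Step (O ∩ Percolation.inside S) u v) : u ∈ S ∧ v ∈ S := by
  obtain ⟨e, he, ⟨rfl, rfl⟩ | ⟨rfl, rfl⟩⟩ := h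
  · exact he.2
  · exact he.2.symm

theorem Conn.mem_inside (h : Conn (O ∩ Percolation.inside S) u v) (hu : u ∈ S) : v ∈ S := by
  induction h with
  | refl => exact hu
  | tail _ h _ => exact h.mem_inside.2

theorem conn_map (τ : ℤ × ℤ → ℤ × ℤ)
    (h : ∀ u v, Step O u v → τ u = τ v ∨ Step O' (τ u) (τ v)) (huv : Conn O u v) :
    Conn O' (τ u) (τ v) := by
  induction huv with
  | refl => exact Conn.refl
  | tail _ hs ih =>
    rcases h _ _ hs with h | h
    · rwa [← h]
    · exact ih.trans h.conn

theorem subset_reach {s : Set (ℤ × ℤ)} : s ⊆ reach O s := fun u hu => ⟨u, hu, Conn.refl⟩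

theorem mem_reach_of_step {s : Set (ℤ × ℤ)} (hu : u ∈ reach O s) (h : Step O u v) :
    v ∈ reach O s := by
  obtain ⟨z, hz, hc⟩ := hu
  exact ⟨z, hz, hc.trans h.conn⟩

/-- The set reached from `s` is not affected by the edges that do not touch it. -/
theorem reach_congr {s : Set (ℤ × ℤ)}
    (h : ∀ e, src e ∈ reach O s ∨ tgt e ∈ reach O s → (e ∈ O ↔ e ∈ O')) :
    reach O' s = reach O s := by
  ext v
  constructor
  · rintro ⟨u, hu, hc⟩
    induction hc with
    | refl => exact subset_reach hu
    | tail _ hs ih =>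
      refine mem_reach_of_step ih ?_
      obtain ⟨e, he, h'⟩ := hs
      refine ⟨e, (h e ?_).2 he, h'⟩
      rcases h' with h' | h'
      · left; rwa [h'.1]
      · right; rwa [h'.2]
  · rintro ⟨u, hu, hc⟩
    refine ⟨u, hu, ?_⟩
    induction hc with
    | refl => exact Conn.refl
    | @tail b c hb hs ih =>
      refine ih.trans (Step.conn ?_)
      obtain ⟨e, he, h'⟩ := hs
      refine ⟨e, (h e ?_).1 he, h'⟩
      rcases h' with h' | h'
      · left; rw [h'.1]; exact ⟨u, hu, hb⟩
      · right; rw [h'.2]; exact ⟨u, hu, hb⟩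

theorem reach_inside_mem (h : v ∈ reach (O ∩ inside S) {u}) (hu : u ∈ S) : v ∈ S := by
  obtain ⟨z, rfl, h⟩ := h
  exact h.mem_inside hu

/-- The lattice rectangle `[a, b] × [c, d]`. -/
def rect (a b c d : ℤ) : Set (ℤ × ℤ) := {z | a ≤ z.1 ∧ z.1 ≤ b ∧ c ≤ z.2 ∧ z.2 ≤ d}

@[simp] theorem mem_rect {a b c d : ℤ} {z : ℤ × ℤ} :
    z ∈ rect a b c d ↔ a ≤ z.1 ∧ z.1 ≤ b ∧ c ≤ z.2 ∧ z.2 ≤ d := Iff.rfl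

theorem finite_rect (a b c d : ℤ) : (rect a b c d).Finite :=
  ((Set.finite_Icc a b).prod (Set.finite_Icc c d)).subset
    fun _ hz => ⟨⟨hz.1, hz.2.1⟩, hz.2.2⟩

theorem finite_inside (hS : S.Finite) : (inside S).Finite :=
  (hS.prod Set.finite_univ).subset fun _ he => ⟨he.1, Set.mem_univ _⟩

theorem finite_inside_rect (a b c d : ℤ) : (inside (rect a b c d)).Finite :=
  finite_inside (finite_rect a b c d)

/-- `O` contains a path crossing `[a, b] × [c, d]` from left to right. -/
def Hcross (O : Set Edge) (a b c d : ℤ) : Prop :=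
  ∃ u v, u ∈ rect a b c d ∧ u.1 = a ∧ v ∈ rect a b c d ∧ v.1 = b ∧
    Conn (O ∩ inside (rect a b c d)) u v

/-- `O` contains a path crossing `[a, b] × [c, d]` from bottom to top. -/
def Vcross (O : Set Edge) (a b c d : ℤ) : Prop :=
  ∃ u v, u ∈ rect a b c d ∧ u.2 = c ∧ v ∈ rect a b c d ∧ v.2 = d ∧
    Conn (O ∩ inside (rect a b c d)) u v

variable {a a' b b' c c' d d' : ℤ}

theorem rect_mono (ha : a' ≤ a) (hb : b ≤ b') (hc : c' ≤ c) (hd : d ≤ d') :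
    rect a b c d ⊆ rect a' b' c' d' := fun z hz => by
  simp only [mem_rect] at *
  omega

theorem Hcross.mono (h : Hcross O a b c d) (hO : O ∩ inside (rect a b c d) ⊆ O') :
    Hcross O' a b c d := by
  obtain ⟨u, v, hu, hu', hv, hv', h⟩ := h
  exact ⟨u, v, hu, hu', hv, hv', h.mono (Set.subset_inter hO Set.inter_subset_right)⟩

theorem Vcross.mono (h : Vcross O a b c d) (hO : O ∩ inside (rect a b c d) ⊆ O') :
    Vcross O' a b c d := by
  obtain ⟨u, v, hu, hu', hv, hv', h⟩ := h
  exact ⟨u, v, hu, hu', hv, hv', h.mono (Set.subset_inter hO Set.inter_subset_right)⟩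

/-- A path ending on the right side contains, after its last visit to the left of the column `a'`,
a crossing of the part of the rectangle to the right of this column. -/
theorem hcross_of_conn (h : Conn (O ∩ inside (rect a b c d)) u v) (hv : v ∈ rect a b c d)
    (hv' : v.1 = b) (hu' : u.1 ≤ a') (ha' : a' ≤ b) : Hcross O a' b c d := by
  suffices key : Hcross O a' b c d ∨ (a' < u.1 ∧ Conn (O ∩ inside (rect a' b c d)) u v) by
    rcases key with h | h
    · exact h
    · omega
  clear hu'
  induction h using Relation.ReflTransGen.head_induction_on with
  | refl =>
    rcases eq_or_lt_of_le ha' with rfl | hlt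
    · have : v ∈ rect a' a' c d := by
        simp only [mem_rect] at *; omega
      exact Or.inl ⟨v, v, this, hv', this, hv', Conn.refl⟩
    · exact Or.inr ⟨by omega, Conn.refl⟩
  | @head x y hs _ ih =>
    rcases ih with h | ⟨hy, hc⟩
    · exact Or.inl h
    have hxy := hs.mem_inside
    simp only [mem_rect] at hxy
    have hx1 : a' ≤ x.1 := by
      rcases step_iff.1 hs with ⟨h, -⟩ | ⟨h, -⟩ | ⟨h, -⟩ | ⟨h, -⟩ <;>
        rw [Prod.ext_iff] at h <;> simp only at h <;> omega
    have hs' := (hs.mono Set.inter_subset_left).inside (S := rect a' b c d)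
      (by simp only [mem_rect]; omega) (by simp only [mem_rect]; omega)
    have hxv := hs'.conn.trans hc
    rcases eq_or_lt_of_le hx1 with h | h
    · refine Or.inl ⟨x, v, ?_, h.symm, ?_, hv', hxv⟩ <;> simp only [mem_rect] at * <;> omega
    · exact Or.inr ⟨h, hxv⟩

theorem Hcross.trim_left (h : Hcross O a b c d) (ha : a ≤ a') (ha' : a' ≤ b) :
    Hcross O a' b c d := by
  obtain ⟨u, v, hu, hu', hv, hv', h⟩ := h
  exact hcross_of_conn h hv hv' (by omega) ha'

theorem Hcross.widen (h : Hcross O a b c d) (hc : c' ≤ c) (hd : d ≤ d') : Hcross O a b c' d' := by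
  obtain ⟨u, v, hu, hu', hv, hv', h⟩ := h
  have hr : rect a b c d ⊆ rect a b c' d' := rect_mono le_rfl le_rfl hc hd
  exact ⟨u, v, hr hu, hu', hr hv, hv',
    h.mono (Set.inter_subset_inter_right _ (inside_mono hr))⟩

/-! ### Planar duality -/

/-- The square with lower left corner `z` is the face `z`. The faces form again a square lattice,
and `crossed e` is the primal edge separating the two faces joined by the dual edge `e`. -/
def crossed : Edge ≃ Edge where
  toFun e := if e.2 then ((e.1.1, e.1.2 + 1), false) else ((e.1.1 + 1, e.1.2), true)
  invFun e := if e.2 then ((e.1.1 - 1, e.1.2), false) else ((e.1.1, e.1.2 - 1), true)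
  left_inv := by rintro ⟨⟨x, y⟩, _ | _⟩ <;> simp
  right_inv := by rintro ⟨⟨x, y⟩, _ | _⟩ <;> simp

@[simp] theorem crossed_true (z : ℤ × ℤ) : crossed (z, true) = ((z.1, z.2 + 1), false) := rfl
@[simp] theorem crossed_false (z : ℤ × ℤ) : crossed (z, false) = ((z.1 + 1, z.2), true) := rfl
@[simp] theorem crossed_symm_true (z : ℤ × ℤ) :
    crossed.symm (z, true) = ((z.1 - 1, z.2), false) := rfl
@[simp] theorem crossed_symm_false (z : ℤ × ℤ) :
    crossed.symm (z, false) = ((z.1, z.2 - 1), true) := rfl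

/-- The dual edges crossing the edges of `O`. -/
def dual (O : Set Edge) : Set Edge := {e | crossed e ∈ O}

/-- The boundary of a 1-chain modulo 2. -/
def bd (k : Edge → ZMod 2) (z : ℤ × ℤ) : ZMod 2 :=
  k (z, false) + k ((z.1 - 1, z.2), false) + k (z, true) + k ((z.1, z.2 - 1), true)

theorem exists_antidiff (g : ℤ → ZMod 2) : ∃ G : ℤ → ZMod 2, ∀ n, G (n + 1) = G n + g n := by
  refine ⟨fun n => ∑ i ∈ Finset.Ico 0 n, g i - ∑ i ∈ Finset.Ico n 0, g i, fun n => ?_⟩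
  beta_reduce
  rcases le_or_gt 0 n with h | h
  · have h1 : Finset.Ico 0 (n + 1) = insert n (Finset.Ico 0 n) := by ext; simp; omega
    rw [h1, Finset.sum_insert (by simp), Finset.Ico_eq_empty (a := n) (by omega),
      Finset.Ico_eq_empty (a := n + 1) (by omega)]
    simp [add_comm]
  · have h1 : Finset.Ico n 0 = insert n (Finset.Ico (n + 1) 0) := by ext; simp; omega
    rw [h1, Finset.sum_insert (by simp), Finset.Ico_eq_empty (b := n) (by omega),
      Finset.Ico_eq_empty (b := n + 1) (by omega)]
    simp only [Finset.sum_empty, zero_sub]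
    ring

theorem const_of_succ {α : Type*} {g : ℤ → α} (h : ∀ n, g (n + 1) = g n) (m n : ℤ) :
    g m = g n := by
  have : ∀ n, g n = g 0 := fun n => by
    induction n using Int.induction_on with
    | zero => rfl
    | succ i ih => rw [h, ih]
    | pred i ih => rw [← ih, ← h (-(i : ℤ) - 1), sub_add_cancel]
  rw [this m, this n]

/-- The discrete Poincaré lemma: every cycle modulo 2 of the square lattice, finite or not, is the
interface of a colouring of the faces with two colours. -/
theorem exists_coloring_of_cycle (k : Edge → ZMod 2) (hk : ∀ z, bd k z = 0) :
    ∃ f : ℤ × ℤ → ZMod 2, ∀ e, f (tgt e) = f (src e) + k (crossed e) := by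
  obtain ⟨A, hA⟩ := exists_antidiff fun x => k ((x + 1, 0), true)
  choose B hB using fun x : ℤ => exists_antidiff fun y => k ((x, y + 1), false)
  refine ⟨fun z => A z.1 + (B z.1 z.2 - B z.1 0), ?_⟩
  rintro ⟨⟨x, y⟩, _ | _⟩
  · simp only [tgt_false, src_mk, crossed_false, hA]
    have hy : ∀ y, (B (x + 1) (y + 1) - B x (y + 1)) - k ((x + 1, y + 1), true)
        = (B (x + 1) y - B x y) - k ((x + 1, y), true) := by
      intro y
      have h := hk (x + 1, y + 1)
      simp only [bd, add_sub_cancel_right] at h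
      rw [hB, hB]
      have h2 : (2 : ZMod 2) = 0 := rfl
      linear_combination (k ((x, y + 1), false) + k ((x + 1, y + 1), true)) * (-1 : ZMod 2) * h2 + h
    have := const_of_succ (g := fun y => (B (x + 1) y - B x y) - k ((x + 1, y), true)) hy y 0
    linear_combination this
  · simp only [tgt_true, src_mk, crossed_true, hB]
    ring

open Classical in
/-- A path from `u` to `v` carries a 1-chain modulo 2 with boundary `u + v`. -/
theorem exists_chain_of_conn (h : Conn O u v) : ∃ k : Edge → ZMod 2,
    (∀ e, k e ≠ 0 → e ∈ O ∧ Conn O u (src e) ∧ Conn O u (tgt e)) ∧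
      ∀ z, bd k z = (if z = u then 1 else 0) + (if z = v then 1 else 0) := by
  induction h with
  | refl =>
    refine ⟨0, fun e h => absurd rfl h, fun z => ?_⟩
    simp only [bd, Pi.zero_apply]
    split_ifs <;> rfl
  | @tail x y hx hs ih =>
    obtain ⟨k, hk, hbd⟩ := ih
    have hs' := hs
    obtain ⟨e, he, hxy⟩ := hs
    refine ⟨fun e' => k e' + if e' = e then 1 else 0, fun e' h => ?_, fun z => ?_⟩
    · by_cases hee : e' = e
      · subst hee
        have hy : Conn O u y := hx.trans hs'.conn
        rcases hxy with ⟨h1, h2⟩ | ⟨h1, h2⟩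
        · rw [h1, h2]; exact ⟨he, hx, hy⟩
        · rw [h1, h2]; exact ⟨he, hy, hx⟩
      · exact hk e' (by simpa [hee] using h)
    · have hb : bd (fun e' => k e' + if e' = e then 1 else 0) z = bd k z +
          ((if z = x then 1 else 0) + if z = y then 1 else 0) := by
        have : bd (fun e' => k e' + if e' = e then 1 else 0) z = bd k z +
          ((if z = src e then 1 else 0) + if z = tgt e then 1 else 0) := by
          obtain ⟨⟨p, q⟩, _ | _⟩ := e <;> obtain ⟨z₁, z₂⟩ := z <;>
            simp only [bd, src_mk, tgt_true, tgt_false, Prod.mk.injEq, and_true, and_false,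
              if_false, Bool.false_eq_true, Bool.true_eq_false, sub_eq_iff_eq_add] <;> ring
        rw [this]
        rcases hxy with ⟨h1, h2⟩ | ⟨h1, h2⟩
        · rw [h1, h2]
        · rw [h1, h2, add_comm (if z = y then (1 : ZMod 2) else 0)]
      rw [hb, hbd]
      split_ifs <;> rfl

/-- A left-right crossing of a rectangle, prolonged by the two horizontal half-lines starting from
its endpoints, separates the face rows below the rectangle from those above it. -/
theorem exists_coloring_of_hcross (h : Conn (O ∩ inside (rect a b c d)) u v)
    (hu : u ∈ rect a b c d) (hu' : u.1 = a) (hv : v ∈ rect a b c d) (hv' : v.1 = b) :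
    ∃ f : ℤ × ℤ → ZMod 2,
      (∀ e, f (tgt e) ≠ f (src e) →
        (crossed e ∈ O ∩ inside (rect a b c d) ∧
          Conn (O ∩ inside (rect a b c d)) u (src (crossed e)) ∧
          Conn (O ∩ inside (rect a b c d)) u (tgt (crossed e))) ∨
        (∃ x, crossed e = ((x, u.2), false) ∧ x < a) ∨
        (∃ x, crossed e = ((x, v.2), false) ∧ b ≤ x)) ∧
      ∀ x x', f (x, c - 1) ≠ f (x', d) := by
  classical
  obtain ⟨k, hk, hbd⟩ := exists_chain_of_conn h
  have huR := mem_rect.1 hu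
  have hvR := mem_rect.1 hv
  let K : Edge → ZMod 2 := fun e => k e + ((if e.2 = false ∧ e.1.2 = u.2 ∧ e.1.1 < a then 1 else 0)
    + (if e.2 = false ∧ e.1.2 = v.2 ∧ b ≤ e.1.1 then 1 else 0))
  have hK : ∀ z, bd K z = 0 := by
    intro z
    have h1 : bd K z = bd k z +
        ((if z = u then 1 else 0) + (if z = v then 1 else 0)) := by
      obtain ⟨z₁, z₂⟩ := z
      obtain ⟨u₁, u₂⟩ := u
      obtain ⟨v₁, v₂⟩ := v
      simp only at hu' hv'
      subst hu' hv'
      have e1 : ((if z₂ = u₂ ∧ z₁ < u₁ then 1 else 0) + (if z₂ = u₂ ∧ z₁ - 1 < u₁ then 1 else 0)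
          : ZMod 2) = if z₁ = u₁ ∧ z₂ = u₂ then 1 else 0 := by
        split_ifs <;> first | rfl | omega
      have e2 : ((if z₂ = v₂ ∧ v₁ ≤ z₁ then 1 else 0) + (if z₂ = v₂ ∧ v₁ ≤ z₁ - 1 then 1 else 0)
          : ZMod 2) = if z₁ = v₁ ∧ z₂ = v₂ then 1 else 0 := by
        split_ifs <;> first | rfl | omega
      simp only [bd, K, Prod.mk.injEq, true_and, Bool.true_eq_false, false_and, if_false]
      rw [← e1, ← e2]
      ring
    rw [h1, hbd]
    split_ifs <;> rfl
  obtain ⟨f, hf⟩ := exists_coloring_of_cycle K hK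
  have hfne : ∀ e, f (tgt e) ≠ f (src e) →
        (crossed e ∈ O ∩ inside (rect a b c d) ∧
          Conn (O ∩ inside (rect a b c d)) u (src (crossed e)) ∧
          Conn (O ∩ inside (rect a b c d)) u (tgt (crossed e))) ∨
        (∃ x, crossed e = ((x, u.2), false) ∧ x < a) ∨
        (∃ x, crossed e = ((x, v.2), false) ∧ b ≤ x) := by
    intro e he
    by_contra hcon
    push Not at hcon
    obtain ⟨h1, h2, h3⟩ := hcon
    apply he
    have hk0 : k (crossed e) = 0 := by
      by_contra h0
      obtain ⟨p, q, r⟩ := hk _ h0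
      exact h1 p q r
    rw [hf, add_eq_left]
    simp only [K, hk0, zero_add]
    rw [if_neg, if_neg, add_zero]
    · rintro ⟨p, q, r⟩
      have := h3 (crossed e).1.1 (Prod.ext (Prod.ext rfl q) p)
      omega
    · rintro ⟨p, q, r⟩
      have := h2 (crossed e).1.1 (Prod.ext (Prod.ext rfl q) p)
      omega
  refine ⟨f, hfne, ?_⟩
  have hrow : ∀ y, (y < c ∨ d ≤ y) → ∀ x x', f (x, y) = f (x', y) := by
    intro y hy x x'
    refine const_of_succ (g := fun x => f (x, y)) (fun n => ?_) x x'
    by_contra hne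
    rcases hfne ((n, y), false) hne with h | h | h
    · have := h.1.2
      simp only [inside, crossed_false, src_mk, tgt_true, mem_rect, Set.mem_ofPred_eq] at this
      omega
    · simp at h
    · simp at h
  have hcol : ∀ y, f (a - 1, y + 1) = f (a - 1, y) + if y + 1 = u.2 then 1 else 0 := by
    intro y
    have h1 := hf ((a - 1, y), true)
    simp only [tgt_true, src_mk, crossed_true] at h1
    have hk0 : k ((a - 1, y + 1), false) = 0 := by
      by_contra h0
      have := (hk _ h0).1.2
      simp only [inside, src_mk, tgt_false, mem_rect, Set.mem_ofPred_eq] at this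
      omega
    rw [h1]
    simp only [K, hk0, zero_add, true_and]
    have hb : ¬ (y + 1 = v.2 ∧ b ≤ a - 1) := by omega
    have hw : (y + 1 = u.2 ∧ a - 1 < a) ↔ y + 1 = u.2 := by omega
    simp only [if_neg hb, hw, add_zero]
  have hlow : ∀ n : ℕ, c - 1 + n < u.2 → f (a - 1, c - 1 + n) = f (a - 1, c - 1) := by
    intro n
    induction n with
    | zero => simp
    | succ n ih =>
      intro hn
      push_cast at hn ⊢
      rw [← add_assoc, hcol, ih (by omega), if_neg (by omega), add_zero]
  have hhigh : ∀ n : ℕ, f (a - 1, u.2 + n) = f (a - 1, c - 1) + 1 := by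
    intro n
    induction n with
    | zero =>
      have h1 := hcol (u.2 - 1)
      rw [if_pos (by omega), sub_add_cancel] at h1
      have h2 := hlow (u.2 - 1 - (c - 1)).toNat (by omega)
      rw [Int.toNat_of_nonneg (by omega), add_sub_cancel] at h2
      simp [h1, h2]
    | succ n ih =>
      push_cast
      rw [← add_assoc, hcol, ih, if_neg (by omega), add_zero]
  intro x x' heq
  have h1 := hhigh (d - u.2).toNat
  rw [Int.toNat_of_nonneg (by omega), add_sub_cancel] at h1
  rw [hrow (c - 1) (by omega) x (a - 1), hrow d (by omega) x' (a - 1), h1] at heq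
  simp at heq

/-- A left-right crossing and a bottom-top path of a rectangle have a common vertex. -/
theorem exists_common_vertex (h : Conn (O ∩ inside (rect a b c d)) u v)
    (hu : u ∈ rect a b c d) (hu' : u.1 = a) (hv : v ∈ rect a b c d) (hv' : v.1 = b)
    {p q : ℤ × ℤ} (h' : Conn (O' ∩ inside (rect a b c d)) p q)
    (hp : p ∈ rect a b c d) (hp' : p.2 = c) (hq' : q.2 = d) :
    ∃ w, Conn (O ∩ inside (rect a b c d)) u w ∧ Conn (O' ∩ inside (rect a b c d)) p w := by
  by_contra hcon
  push Not at hcon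
  obtain ⟨f, hf, hne⟩ := exists_coloring_of_hcross h hu hu' hv hv'
  -- the four faces around a vertex off the crossing and in the rectangle have the same colour
  have hloc : ∀ w, Conn (O' ∩ inside (rect a b c d)) p w → ∀ e,
      (src (crossed e) = w ∨ tgt (crossed e) = w) → f (tgt e) = f (src e) := by
    intro w hw e he
    by_contra hfe
    have hwR := mem_rect.1 (hw.mem_inside hp)
    rcases hf e hfe with ⟨-, h1, h2⟩ | ⟨x, h1, h2⟩ | ⟨x, h1, h2⟩
    · rcases he with rfl | rfl
      · exact hcon _ h1 hw
      · exact hcon _ h2 hw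
    · rw [h1] at he
      simp only [src_mk, tgt_false] at he
      have : w = u := by
        rcases he with rfl | rfl
        · simp only at hwR; omega
        · simp only at hwR; exact Prod.ext (by simp only; omega) rfl
      exact hcon u Conn.refl (this ▸ hw)
    · rw [h1] at he
      simp only [src_mk, tgt_false] at he
      have : w = v := by
        rcases he with rfl | rfl
        · simp only at hwR; exact Prod.ext (by simp only; omega) rfl
        · simp only at hwR; omega
      exact hcon v h (this ▸ hw)
  have hleft : ∀ w, Conn (O' ∩ inside (rect a b c d)) p w → f w = f (w.1 - 1, w.2) := fun w hw => by
    have := hloc w hw ((w.1 - 1, w.2), false) (by simp)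
    simpa using this
  have hdown : ∀ w, Conn (O' ∩ inside (rect a b c d)) p w → f w = f (w.1, w.2 - 1) := fun w hw => by
    have := hloc w hw ((w.1, w.2 - 1), true) (by simp)
    simpa using this
  have hconst : ∀ w, Conn (O' ∩ inside (rect a b c d)) p w → f w = f p := by
    intro w hw
    induction hw with
    | refl => rfl
    | @tail x y hx hs ih =>
      have hy := Relation.ReflTransGen.tail hx hs
      rw [← ih]
      rcases step_iff.1 hs with ⟨rfl, -⟩ | ⟨rfl, -⟩ | ⟨rfl, -⟩ | ⟨rfl, -⟩
      · simpa using hleft _ hy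
      · simpa using (hleft _ hx).symm
      · simpa using hdown _ hy
      · simpa using (hdown _ hx).symm
  apply hne p.1 q.1
  rw [← hp', ← hq', ← hdown p Conn.refl, ← hconst q h']

/-- A rectangle cannot have both a left-right crossing and a bottom-top dual crossing that avoid
each other. -/
theorem not_hcross_and_dual_vcross (hO : Disjoint O O') (h : Hcross O a b c d)
    (h' : Vcross (dual O') a (b - 1) (c - 1) d) : False := by
  obtain ⟨u, v, hu, hu', hv, hv', h⟩ := h
  obtain ⟨p, q, hp, hp', hq, hq', h'⟩ := h'
  obtain ⟨f, hf, hne⟩ := exists_coloring_of_hcross h hu hu' hv hv'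
  have hconst : f q = f p := by
    have hedge : ∀ e ∈ dual O' ∩ inside (rect a (b - 1) (c - 1) d), f (tgt e) = f (src e) := by
      rintro e ⟨he, heR⟩
      by_contra hfe
      have heR1 := mem_rect.1 heR.1
      rcases hf e hfe with ⟨h1, -, -⟩ | ⟨x, h1, h2⟩ | ⟨x, h1, h2⟩
      · exact Set.disjoint_left.1 hO h1.1 he
      · rw [← Equiv.eq_symm_apply, crossed_symm_false] at h1
        rw [h1] at heR1
        simp only [src_mk] at heR1
        omega
      · rw [← Equiv.eq_symm_apply, crossed_symm_false] at h1
        rw [h1] at heR1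
        simp only [src_mk] at heR1
        omega
    clear hq hq'
    induction h' with
    | refl => rfl
    | tail _ hs ih =>
      obtain ⟨e, he, ⟨rfl, rfl⟩ | ⟨rfl, rfl⟩⟩ := hs
      · rw [hedge e he, ih]
      · rw [← hedge e he, ih]
  apply hne p.1 q.1
  rw [← hp', ← hq']
  exact hconst.symm

/-! ### Interfaces and the exploration of a rectangle -/

/-- The edges separating a face of `C` from a face outside `C`. -/
def interface (C : Set (ℤ × ℤ)) : Set Edge :=
  {e | ¬ (src (crossed.symm e) ∈ C ↔ tgt (crossed.symm e) ∈ C)}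

/-- If neither `C` nor its complement can be split by a colouring that changes only across the
interface of `C`, then this interface is connected: a connected component of the interface is a
cycle, hence the interface of a colouring, which can only be the one given by `C`. -/
theorem conn_interface {C : Set (ℤ × ℤ)}
    (hC : ∀ f : ℤ × ℤ → ZMod 2, (∀ e, f (tgt e) ≠ f (src e) → crossed e ∈ interface C) →
      (∀ z ∈ C, ∀ z' ∈ C, f z = f z') ∧ ∀ z ∉ C, ∀ z' ∉ C, f z = f z')
    {e e' : Edge} (he : e ∈ interface C) (he' : e' ∈ interface C) :
    Conn (interface C) (src e) (src e') := by
  classical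
  let χ : ℤ × ℤ → ZMod 2 := fun z => if z ∈ C then 1 else 0
  let ι : Edge → ZMod 2 := fun e => if e ∈ interface C then 1 else 0
  have hι : ∀ e, ι e = χ (src (crossed.symm e)) + χ (tgt (crossed.symm e)) := by
    intro e
    simp only [ι, χ, interface, Set.mem_ofPred_eq]
    by_cases h1 : src (crossed.symm e) ∈ C <;> by_cases h2 : tgt (crossed.symm e) ∈ C <;>
      simp only [h1, h2] <;> rfl
  have hbdι : ∀ z, bd ι z = 0 := by
    intro z
    have h2 : (2 : ZMod 2) = 0 := rfl
    simp only [bd, hι, crossed_symm_true, crossed_symm_false, src_mk, tgt_true, tgt_false,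
      sub_add_cancel]
    linear_combination (χ (z.1, z.2 - 1) + χ (z.1, z.2) + χ (z.1 - 1, z.2 - 1) +
      χ (z.1 - 1, z.2)) * h2
  let k : Edge → ZMod 2 := fun e' => if Conn (interface C) (src e) (src e') then ι e' else 0
  have hk : ∀ z, bd k z = 0 := by
    intro z
    have hinc : ∀ e', (src e' = z ∨ tgt e' = z) →
        k e' = if Conn (interface C) (src e) z then ι e' else 0 := by
      intro e' h
      by_cases hm : e' ∈ interface C
      · have : Conn (interface C) (src e) (src e') ↔ Conn (interface C) (src e) z := by
          rcases h with rfl | rfl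
          · rfl
          · exact ⟨fun h => h.trans (step_of_mem hm).conn,
              fun h => h.trans (step_of_mem hm).symm.conn⟩
        simp only [k, this]
      · simp [k, ι, hm]
    have hbd : bd k z = if Conn (interface C) (src e) z then bd ι z else 0 := by
      simp only [bd]
      rw [hinc (z, false) (by simp), hinc ((z.1 - 1, z.2), false) (by simp),
        hinc (z, true) (by simp), hinc ((z.1, z.2 - 1), true) (by simp)]
      split_ifs <;> simp
    rw [hbd, hbdι, ite_self]
  obtain ⟨f, hf⟩ := exists_coloring_of_cycle k hk
  obtain ⟨h1, h2⟩ := hC f fun e' hne => by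
    by_contra hm
    apply hne
    rw [hf]
    simp [k, ι, hm]
  -- `f` takes different values on both sides of `e`, hence on both sides of `e'`
  have hval : ∀ e', f (tgt (crossed.symm e')) = f (src (crossed.symm e')) + k e' := fun e' => by
    rw [hf, Equiv.apply_symm_apply]
  have hke : k e = 1 := by simp [k, ι, he, Conn.refl]
  have hke' : k e' ≠ 0 := by
    intro h0
    have v1 := hval e
    have v2 := hval e'
    rw [hke] at v1
    rw [h0, add_zero] at v2
    have : f (tgt (crossed.symm e)) = f (src (crossed.symm e)) := by
      simp only [interface, Set.mem_ofPred_eq] at he he'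
      by_cases p1 : src (crossed.symm e) ∈ C <;> by_cases p2 : src (crossed.symm e') ∈ C
      · have q1 : tgt (crossed.symm e) ∉ C := by tauto
        have q2 : tgt (crossed.symm e') ∉ C := by tauto
        rw [h2 _ q1 _ q2, v2, h1 _ p1 _ p2]
      · have q1 : tgt (crossed.symm e) ∉ C := by tauto
        have q2 : tgt (crossed.symm e') ∈ C := by tauto
        rw [h2 _ q1 _ p2, ← v2, h1 _ p1 _ q2]
      · have q1 : tgt (crossed.symm e) ∈ C := by tauto
        have q2 : tgt (crossed.symm e') ∉ C := by tauto
        rw [h1 _ q1 _ p2, ← v2, h2 _ p1 _ q2]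
      · have q1 : tgt (crossed.symm e) ∈ C := by tauto
        have q2 : tgt (crossed.symm e') ∈ C := by tauto
        rw [h1 _ q1 _ q2, v2, h2 _ p1 _ p2]
    rw [this] at v1
    simp at v1
  by_contra hcon
  exact hke' (by simp [k, hcon])

/-- The horizontal edges on or below the bottom line and on or above the top line of
`ℤ × [c, d]`. -/
def outerEdges (c d : ℤ) : Set Edge := {e | e.2 = false ∧ (e.1.2 ≤ c ∨ d ≤ e.1.2)}

/-- The edges that the exploration of `[a, b] × [c, d]` may cross: the closed edges of the
rectangle, and the horizontal edges not strictly between its bottom and its top, which makes the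
explored set invariant under vertical translation above and below the rectangle. -/
def crossable (O : Set Edge) (a b c d : ℤ) : Set Edge :=
  (Oᶜ ∩ inside (rect a b c d)) ∪ outerEdges c d

/-- The faces explored from the left of `[a, b] × [c, d]` by dual paths of closed edges. -/
def explored (O : Set Edge) (a b c d : ℤ) : Set (ℤ × ℤ) :=
  reach (dual (crossable O a b c d)) {z | z.1 ≤ a - 1}

/-- The component of the complement of `D` that contains the half-plane to the right of the
column `b`. -/
def rightPart (D : Set (ℤ × ℤ)) (b : ℤ) : Set (ℤ × ℤ) :=
  reach (Set.univ ∩ inside Dᶜ) {z | b ≤ z.1}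

theorem step_dual_of_mem (h : e ∈ O) : Step (dual O) (src (crossed.symm e)) (tgt (crossed.symm e)) :=
  step_of_mem (by simpa [dual] using h)

/-- A dual path from the left to the right of the rectangle yields a closed dual crossing. -/
theorem hcross_dual_of_explored (hcd : c < d) {z : ℤ × ℤ} (hz : z ∈ explored O a b c d)
    (hab : a ≤ b) (hzb : b ≤ z.1) : Hcross (dual Oᶜ) (a - 1) b c (d - 1) := by
  obtain ⟨z₀, hz₀, hpath⟩ := hz
  let τ : ℤ × ℤ → ℤ × ℤ := fun z => (z.1, max c (min z.2 (d - 1)))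
  have key : z.1 ≤ a - 1 ∨ ∃ u ∈ rect (a - 1) b c (d - 1), u.1 = a - 1 ∧
      Conn (dual Oᶜ ∩ inside (rect (a - 1) b c (d - 1))) u (τ z) := by
    clear hzb
    induction hpath with
    | refl => exact Or.inl hz₀
    | @tail x y _ hs ih =>
      obtain ⟨e, he, hxy⟩ := hs
      have hout : τ x = τ y → x.1 = y.1 → y.1 ≤ a - 1 ∨ ∃ u ∈ rect (a - 1) b c (d - 1),
          u.1 = a - 1 ∧ Conn (dual Oᶜ ∩ inside (rect (a - 1) b c (d - 1))) u (τ y) := by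
        intro h1 h2
        rwa [h1, h2] at ih
      have hin : e ∈ dual Oᶜ → x ∈ rect (a - 1) b c (d - 1) → y ∈ rect (a - 1) b c (d - 1) →
          y.1 ≤ a - 1 ∨ ∃ u ∈ rect (a - 1) b c (d - 1),
          u.1 = a - 1 ∧ Conn (dual Oᶜ ∩ inside (rect (a - 1) b c (d - 1))) u (τ y) := by
        intro h1 h2 h3
        have hst : Step (dual Oᶜ ∩ inside (rect (a - 1) b c (d - 1))) x y :=
          Step.inside ⟨e, h1, hxy⟩ h2 h3
        have hτ : ∀ z ∈ rect (a - 1) b c (d - 1), τ z = z := fun z hz => by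
          simp only [mem_rect] at hz
          exact Prod.ext rfl (by simp only [τ]; omega)
        rw [hτ y h3]
        rw [hτ x h2] at ih
        right
        rcases ih with h | ⟨u, hu, hu', hc⟩
        · exact ⟨x, h2, by simp only [mem_rect] at h2; omega, hst.conn⟩
        · exact ⟨u, hu, hu', hc.trans hst.conn⟩
      obtain ⟨⟨p, q⟩, _ | _⟩ := e
      · rcases he with ⟨he, heR⟩ | ⟨he, -⟩
        · simp only [inside, crossed_false, src_mk, tgt_true, mem_rect, Set.mem_ofPred_eq] at heR
          rcases hxy with ⟨rfl, rfl⟩ | ⟨rfl, rfl⟩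
          · refine hin he ?_ ?_ <;> simp <;> omega
          · refine hin he ?_ ?_ <;> simp <;> omega
        · simp at he
      · by_cases hq : q + 1 ≤ c ∨ d ≤ q + 1
        · rcases hxy with ⟨rfl, rfl⟩ | ⟨rfl, rfl⟩
          · refine hout (Prod.ext rfl ?_) rfl
            simp only [src_mk, tgt_true, τ]; omega
          · refine hout (Prod.ext rfl ?_) rfl
            simp only [src_mk, tgt_true, τ]; omega
        · rcases he with ⟨he, heR⟩ | ⟨-, he⟩
          · simp only [inside, crossed_true, src_mk, tgt_false, mem_rect,
              Set.mem_ofPred_eq] at heR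
            rcases hxy with ⟨rfl, rfl⟩ | ⟨rfl, rfl⟩
            · refine hin he ?_ ?_ <;> simp <;> omega
            · refine hin he ?_ ?_ <;> simp <;> omega
          · exact absurd he hq
  rcases key with h | ⟨u, hu, hu', hc⟩
  · omega
  · have hm := hc.mem_inside hu
    have hm1 : (τ z).1 = z.1 := rfl
    refine ⟨u, τ z, hu, hu', hm, ?_, hc⟩
    simp only [mem_rect] at hm
    omega

theorem mem_explored_of_le {z : ℤ × ℤ} (hz : z.1 ≤ a - 1) : z ∈ explored O a b c d :=
  subset_reach hz

theorem mem_rightPart_of_le {D : Set (ℤ × ℤ)} {z : ℤ × ℤ} (hz : b ≤ z.1) : z ∈ rightPart D b :=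
  subset_reach hz

theorem notMem_of_mem_rightPart {D : Set (ℤ × ℤ)} (hD : ∀ z ∈ D, z.1 < b) {z : ℤ × ℤ}
    (hz : z ∈ rightPart D b) : z ∉ D := by
  obtain ⟨z₀, hz₀, h⟩ := hz
  exact h.mem_inside (S := Dᶜ) fun h' => absurd (hD _ h') (not_lt.2 hz₀)

theorem mem_rightPart_of_step {D : Set (ℤ × ℤ)} (hD : ∀ z ∈ D, z.1 < b) {z z' : ℤ × ℤ}
    (hz : z ∈ rightPart D b) (h : Step Set.univ z z') (hz' : z' ∉ D) : z' ∈ rightPart D b :=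
  mem_reach_of_step hz (h.inside (notMem_of_mem_rightPart hD hz) hz')

/-- An edge of the interface separates an explored face from a face of the right part. In
particular the exploration did not cross it. -/
theorem notMem_crossable_of_mem_interface (hD : ∀ z ∈ explored O a b c d, z.1 < b)
    (he : e ∈ interface (rightPart (explored O a b c d) b)) :
    e ∉ crossable O a b c d ∧
      ((src (crossed.symm e) ∈ explored O a b c d ∧
        tgt (crossed.symm e) ∈ rightPart (explored O a b c d) b) ∨
      (tgt (crossed.symm e) ∈ explored O a b c d ∧
        src (crossed.symm e) ∈ rightPart (explored O a b c d) b)) := by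
  have hst : Step Set.univ (src (crossed.symm e)) (tgt (crossed.symm e)) :=
    step_of_mem (Set.mem_univ _)
  have hor : (src (crossed.symm e) ∈ explored O a b c d ∧
        tgt (crossed.symm e) ∈ rightPart (explored O a b c d) b) ∨
      (tgt (crossed.symm e) ∈ explored O a b c d ∧
        src (crossed.symm e) ∈ rightPart (explored O a b c d) b) := by
    simp only [interface, Set.mem_ofPred_eq] at he
    by_cases h1 : src (crossed.symm e) ∈ rightPart (explored O a b c d) b
    · have h2 : tgt (crossed.symm e) ∉ rightPart (explored O a b c d) b := by tauto
      refine Or.inr ⟨?_, h1⟩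
      by_contra h3
      exact h2 (mem_rightPart_of_step hD h1 hst h3)
    · have h2 : tgt (crossed.symm e) ∈ rightPart (explored O a b c d) b := by tauto
      refine Or.inl ⟨?_, h2⟩
      by_contra h3
      exact h1 (mem_rightPart_of_step hD h2 hst.symm h3)
  refine ⟨fun hcr => ?_, hor⟩
  rcases hor with ⟨h1, h2⟩ | ⟨h1, h2⟩
  · exact notMem_of_mem_rightPart hD h2 (mem_reach_of_step h1 (step_dual_of_mem hcr))
  · exact notMem_of_mem_rightPart hD h2 (mem_reach_of_step h1 (step_dual_of_mem hcr).symm)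

theorem bounds_of_mem_interface (hD : ∀ z ∈ explored O a b c d, z.1 < b)
    (he : e ∈ interface (rightPart (explored O a b c d) b)) :
    (e.2 = false → c < e.1.2 ∧ e.1.2 < d ∧ a ≤ e.1.1 ∧ e.1.1 < b) ∧
      (e.2 = true → a ≤ e.1.1 ∧ e.1.1 ≤ b) := by
  obtain ⟨hcr, hor⟩ := notMem_crossable_of_mem_interface hD he
  have hL : ∀ z ∈ rightPart (explored O a b c d) b, ¬ z.1 ≤ a - 1 := fun z hz h =>
    notMem_of_mem_rightPart hD hz (mem_explored_of_le h)
  have hR : ∀ z ∈ explored O a b c d, ¬ b ≤ z.1 := fun z hz h => absurd (hD z hz) (not_lt.2 h)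
  have hout : e ∉ outerEdges c d := fun h => hcr (Or.inr h)
  obtain ⟨⟨x, y⟩, _ | _⟩ := e
  · simp only [outerEdges, Set.mem_ofPred_eq, true_and, not_or, not_le] at hout
    refine ⟨fun _ => ?_, by simp⟩
    rcases hor with ⟨h1, h2⟩ | ⟨h1, h2⟩ <;>
    · have := hL _ h2
      have := hR _ h1
      simp only [crossed_symm_false, src_mk, tgt_true] at *
      omega
  · refine ⟨by simp, fun _ => ?_⟩
    rcases hor with ⟨h1, h2⟩ | ⟨h1, h2⟩ <;>
    · have := hL _ h2
      have := hR _ h1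
      simp only [crossed_symm_true, src_mk, tgt_false] at *
      omega

/-- A function constant along the dual edges in a half-plane is constant on it. -/
theorem const_on_halfPlane {f : ℤ × ℤ → ZMod 2} {m : ℤ} {P : ℤ → Prop}
    (hP : (∀ x, P x ↔ m ≤ x) ∨ ∀ x, P x ↔ x ≤ m)
    (h : ∀ e, P (src e).1 → P (tgt e).1 → f (tgt e) = f (src e)) {z z' : ℤ × ℤ}
    (hz : P z.1) (hz' : P z'.1) : f z = f z' := by
  have hv : ∀ x, P x → ∀ y y', f (x, y) = f (x, y') := fun x hx y y' =>
    const_of_succ (g := fun y => f (x, y)) (fun n => h ((x, n), true) hx hx) y y'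
  have hh : ∀ x, P x → f (x, 0) = f (m, 0) := by
    rcases hP with hP | hP
    · intro x hx
      have := (hP x).1 hx
      induction x, this using Int.leInduction with
      | base => rfl
      | succ n hn ih =>
        have hn' := (hP n).2 hn
        exact (h ((n, 0), false) hn' hx).trans (ih hn')
    · intro x hx
      have := (hP x).1 hx
      induction x, this using Int.leInductionDown with
      | base => rfl
      | pred n hn ih =>
        have hn' := (hP n).2 hn
        have := h ((n - 1, 0), false) hx (by simpa using hn')
        simp only [tgt_false, sub_add_cancel, src_mk] at this
        exact this.symm.trans (ih hn')
  rw [← Prod.mk.eta (p := z), ← Prod.mk.eta (p := z'), hv _ hz z.2 0, hv _ hz' z'.2 0, hh _ hz,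
    hh _ hz']

/-- The interface between the right part and the rest is connected. -/
theorem conn_interface_rightPart (hD : ∀ z ∈ explored O a b c d, z.1 < b) {e e' : Edge}
    (he : e ∈ interface (rightPart (explored O a b c d) b))
    (he' : e' ∈ interface (rightPart (explored O a b c d) b)) :
    Conn (interface (rightPart (explored O a b c d) b)) (src e) (src e') := by
  set D := explored O a b c d
  set C := rightPart D b
  refine conn_interface (fun f hf => ?_) he he'
  have hsame : ∀ z z', Step Set.univ z z' → (z ∈ C ↔ z' ∈ C) → f z = f z' := by
    intro z z' hs hzz
    obtain ⟨e, -, h⟩ := hs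
    have : f (tgt e) = f (src e) := by
      by_contra hne
      have := hf e hne
      simp only [interface, Set.mem_ofPred_eq, Equiv.symm_apply_apply] at this
      rcases h with ⟨rfl, rfl⟩ | ⟨rfl, rfl⟩ <;> tauto
    rcases h with ⟨rfl, rfl⟩ | ⟨rfl, rfl⟩
    · exact this.symm
    · exact this
  have hedge : ∀ e : Edge, Step Set.univ (tgt e) (src e) := fun e =>
    (step_of_mem (Set.mem_univ e)).symm
  have hright : ∀ z z' : ℤ × ℤ, b ≤ z.1 → b ≤ z'.1 → f z = f z' := fun z z' hz hz' =>
    const_on_halfPlane (P := fun x => b ≤ x) (m := b) (Or.inl fun _ => Iff.rfl)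
      (fun e h1 h2 => hsame _ _ (hedge e)
        (iff_of_true (mem_rightPart_of_le h2) (mem_rightPart_of_le h1))) hz hz'
  have hDC : ∀ z ∈ D, z ∉ C := fun z hz h => notMem_of_mem_rightPart hD h hz
  have hleft : ∀ z z' : ℤ × ℤ, z.1 ≤ a - 1 → z'.1 ≤ a - 1 → f z = f z' := fun z z' hz hz' =>
    const_on_halfPlane (P := fun x => x ≤ a - 1) (m := a - 1) (Or.inr fun _ => Iff.rfl)
      (fun e h1 h2 => hsame _ _ (hedge e)
        (iff_of_false (hDC _ (mem_explored_of_le h2)) (hDC _ (mem_explored_of_le h1)))) hz hz'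
  have hC : ∀ z ∈ C, f z = f (b, 0) := by
    rintro z ⟨z₀, hz₀, hc⟩
    rw [← hright z₀ (b, 0) hz₀ le_rfl]
    induction hc with
    | refl => rfl
    | @tail x y hx hs ih =>
      have hxC : x ∈ C := ⟨z₀, hz₀, hx⟩
      have hyC : y ∈ C := mem_reach_of_step hxC hs
      rw [← ih]
      exact (hsame _ _ (hs.mono (Set.subset_univ _)) (iff_of_true hxC hyC)).symm
  have hDf : ∀ z ∈ D, f z = f (a - 1, 0) := by
    rintro z ⟨z₀, hz₀, hc⟩
    rw [← hleft z₀ (a - 1, 0) hz₀ le_rfl]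
    induction hc with
    | refl => rfl
    | @tail x y hx hs ih =>
      have hxC : x ∈ D := ⟨z₀, hz₀, hx⟩
      have hyC : y ∈ D := mem_reach_of_step hxC hs
      rw [← ih]
      exact (hsame _ _ (hs.mono (Set.subset_univ _)) (iff_of_false (hDC _ hxC) (hDC _ hyC))).symm
  -- outside `C`, one reaches an explored face by moving to the left
  have hCc : ∀ n : ℕ, ∀ z : ℤ × ℤ, z ∉ C → z.1 ≤ a - 1 + n → f z = f (a - 1, 0) := by
    intro n
    induction n with
    | zero => exact fun z _ hz => hDf z (mem_explored_of_le (by simpa using hz))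
    | succ n ih =>
      intro z hz hzn
      by_cases hzD : z ∈ D
      · exact hDf z hzD
      · have hst : Step Set.univ (z.1 - 1, z.2) z :=
          step_iff.2 (Or.inl ⟨by simp, Set.mem_univ _⟩)
        have hl : (z.1 - 1, z.2) ∉ C := fun h => hz (mem_rightPart_of_step hD h hst hzD)
        rw [← hsame _ _ hst (iff_of_false hl hz)]
        exact ih _ hl (by push_cast at hzn; simp only; omega)
  refine ⟨fun z hz z' hz' => (hC z hz).trans (hC z' hz').symm, fun z hz z' hz' => ?_⟩
  rw [hCc (z.1 - (a - 1)).toNat z hz (by omega), hCc (z'.1 - (a - 1)).toNat z' hz' (by omega)]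

/-- Moving the endpoints of the interface vertically into the rectangle, one gets a connected set
of open edges of the rectangle. -/
theorem conn_clamp_interface (hcd : c ≤ d) (hD : ∀ z ∈ explored O a b c d, z.1 < b) {e e' : Edge}
    (he : e ∈ interface (rightPart (explored O a b c d) b))
    (he' : e' ∈ interface (rightPart (explored O a b c d) b))
    (hu : src e = u ∨ tgt e = u) (hv : src e' = v ∨ tgt e' = v) :
    Conn (O ∩ inside (rect a b c d)) (u.1, max c (min u.2 d)) (v.1, max c (min v.2 d)) := by
  have huv : Conn (interface (rightPart (explored O a b c d) b)) u v := by
    have h := conn_interface_rightPart hD he he'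
    have h1 := (step_of_mem he).conn
    have h2 := (step_of_mem he').conn
    rcases hu with rfl | rfl <;> rcases hv with rfl | rfl
    · exact h
    · exact h.trans h2
    · exact h1.symm.trans h
    · exact h1.symm.trans (h.trans h2)
  refine conn_map (fun z => (z.1, max c (min z.2 d))) (fun x y hs => ?_) huv
  suffices h : ∀ e ∈ interface (rightPart (explored O a b c d) b),
      ((src e).1, max c (min (src e).2 d)) = ((tgt e).1, max c (min (tgt e).2 d)) ∨
      Step (O ∩ inside (rect a b c d)) ((src e).1, max c (min (src e).2 d))
        ((tgt e).1, max c (min (tgt e).2 d)) by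
    obtain ⟨e, he, ⟨rfl, rfl⟩ | ⟨rfl, rfl⟩⟩ := hs
    · exact h e he
    · exact (h e he).imp Eq.symm Step.symm
  intro e he
  have hb := bounds_of_mem_interface hD he
  have hcr := (notMem_crossable_of_mem_interface hD he).1
  have hopen : e ∈ inside (rect a b c d) → e ∈ O := fun h => by
    by_contra hO
    exact hcr (Or.inl ⟨hO, h⟩)
  have hmem : e ∈ inside (rect a b c d) → Step (O ∩ inside (rect a b c d))
      ((src e).1, max c (min (src e).2 d)) ((tgt e).1, max c (min (tgt e).2 d)) := fun h => by
    have hcl : ∀ z ∈ rect a b c d, (z.1, max c (min z.2 d)) = z := fun z hz => by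
      simp only [mem_rect] at hz
      exact Prod.ext rfl (by simp only; omega)
    rw [hcl _ h.1, hcl _ h.2]
    exact step_of_mem ⟨hopen h, h⟩
  obtain ⟨⟨x, y⟩, _ | _⟩ := e
  · refine Or.inr (hmem ?_)
    have := hb.1 rfl
    simp only [inside, src_mk, tgt_false, mem_rect, Set.mem_ofPred_eq] at *
    omega
  · have := hb.2 rfl
    by_cases hy : c ≤ y ∧ y + 1 ≤ d
    · refine Or.inr (hmem ?_)
      simp only [inside, src_mk, tgt_true, mem_rect, Set.mem_ofPred_eq] at *
      omega
    · left
      simp only [src_mk, tgt_true, Prod.mk.injEq, true_and] at *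
      omega

theorem exists_mem_interface (hD : ∀ z ∈ explored O a b c d, z.1 < b) (y : ℤ) :
    ∃ x, ((x, y), true) ∈ interface (rightPart (explored O a b c d) b) := by
  by_contra hcon
  push Not at hcon
  have hab : a - 1 < b := hD (a - 1, 0) (mem_explored_of_le le_rfl)
  have : ∀ x, a - 1 ≤ x → (x, y) ∉ rightPart (explored O a b c d) b := by
    intro x hx
    induction x, hx using Int.leInduction with
    | base => exact fun h => notMem_of_mem_rightPart hD h (mem_explored_of_le le_rfl)
    | succ n _ ih =>
      have := hcon (n + 1)
      simp only [interface, Set.mem_ofPred_eq, not_not, crossed_symm_true, src_mk, tgt_false,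
        add_sub_cancel_right] at this
      exact fun h => ih (this.2 h)
  exact this b hab.le (mem_rightPart_of_le le_rfl)

/-- If the exploration from the left does not reach the right side, then the rectangle has an open
vertical crossing, and it is connected to all the interface vertices of the rectangle. -/
theorem vcross_of_explored (hcd : c ≤ d) (hD : ∀ z ∈ explored O a b c d, z.1 < b) :
    ∃ u v, u ∈ rect a b c d ∧ u.2 = c ∧ v ∈ rect a b c d ∧ v.2 = d ∧
      Conn (O ∩ inside (rect a b c d)) u v ∧
      ∀ w ∈ rect a b c d, ∀ e ∈ interface (rightPart (explored O a b c d) b),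
        (src e = w ∨ tgt e = w) → Conn (O ∩ inside (rect a b c d)) u w := by
  obtain ⟨x, hx⟩ := exists_mem_interface hD c
  obtain ⟨x', hx'⟩ := exists_mem_interface hD d
  have hxb := (bounds_of_mem_interface hD hx).2 rfl
  have hxb' := (bounds_of_mem_interface hD hx').2 rfl
  have hcl : ∀ z ∈ rect a b c d, (z.1, max c (min z.2 d)) = z := fun z hz => by
    simp only [mem_rect] at hz
    exact Prod.ext rfl (by simp only; omega)
  have hu : (x, c) ∈ rect a b c d := by simp only [mem_rect] at *; omega
  have hv : (x', d) ∈ rect a b c d := by simp only [mem_rect] at *; omega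
  refine ⟨(x, c), (x', d), hu, rfl, hv, rfl, ?_, fun w hw e he hew => ?_⟩
  · have := conn_clamp_interface hcd hD hx hx' (Or.inl rfl) (Or.inl rfl)
    rwa [src_mk, src_mk, hcl _ hu, hcl _ hv] at this
  · have := conn_clamp_interface hcd hD hx he (Or.inl rfl) hew
    rwa [src_mk, hcl _ hu, hcl _ hw] at this

/-- Planar duality: a rectangle without a closed horizontal dual crossing has an open vertical
crossing. -/
theorem vcross_or_hcross_dual (hcd : c < d) (hab : a ≤ b) :
    Vcross O a b c d ∨ Hcross (dual Oᶜ) (a - 1) b c (d - 1) := by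
  by_cases hD : ∀ z ∈ explored O a b c d, z.1 < b
  · obtain ⟨u, v, h1, h2, h3, h4, h5, -⟩ := vcross_of_explored hcd.le hD
    exact Or.inl ⟨u, v, h1, h2, h3, h4, h5⟩
  · push Not at hD
    obtain ⟨z, hz, hzb⟩ := hD
    exact Or.inr (hcross_dual_of_explored hcd hz hab hzb)

/-! ### Increasing events and lattice symmetries -/

/-- `P` is an increasing property of the set of open edges that depends only on the edges
of `F`. -/
def IncreasingOn (P : Set Edge → Prop) (F : Set Edge) : Prop :=
  ∀ ⦃O O'⦄, P O → O ∩ F ⊆ O' → P O'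

section IncreasingOn

variable {P P' : Set Edge → Prop} {F F' : Set Edge}

theorem IncreasingOn.dependsOn (h : IncreasingOn P F) :
    DependsOn (· ∈ {ω | P (opn ω)}) F := by
  intro ω ω' hω
  refine propext ⟨fun h' => h h' fun e he => ?_, fun h' => h h' fun e he => ?_⟩
  · exact (hω e he.2).symm.trans he.1
  · exact (hω e he.2).trans he.1

theorem IncreasingOn.isUpperSet (h : IncreasingOn P F) : IsUpperSet {ω | P (opn ω)} := by
  intro ω ω' hω h'
  refine h h' fun e he => ?_
  have h1 : ω e = true := he.1
  have h2 := hω e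
  rw [h1] at h2
  exact top_le_iff.1 h2

theorem IncreasingOn.mono_set (h : IncreasingOn P F) (hF : F ⊆ F') : IncreasingOn P F' :=
  fun _ _ hP hO => h hP ((Set.inter_subset_inter_right _ hF).trans hO)

theorem IncreasingOn.and (h : IncreasingOn P F) (h' : IncreasingOn P' F) :
    IncreasingOn (fun O => P O ∧ P' O) F :=
  fun _ _ hP hO => ⟨h hP.1 hO, h' hP.2 hO⟩

theorem IncreasingOn.or (h : IncreasingOn P F) (h' : IncreasingOn P' F) :
    IncreasingOn (fun O => P O ∨ P' O) F :=
  fun _ _ hP hO => hP.imp (fun h₁ => h h₁ hO) fun h₁ => h' h₁ hO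

theorem IncreasingOn.harris (h : IncreasingOn P F) (h' : IncreasingOn P' F) (hF : F.Finite)
    (p : I) : (bern Edge p).real {ω | P (opn ω)} * (bern Edge p).real {ω | P' (opn ω)} ≤
      (bern Edge p).real {ω | P (opn ω) ∧ P' (opn ω)} :=
  Percolation.harris hF h.dependsOn h'.dependsOn h.isUpperSet h'.isUpperSet

theorem IncreasingOn.harris_compl (h : IncreasingOn P F) (h' : IncreasingOn P' F) (hF : F.Finite)
    (p : I) : (1 - (bern Edge p).real {ω | P (opn ω)}) *
      (1 - (bern Edge p).real {ω | P' (opn ω)}) ≤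
      1 - (bern Edge p).real {ω | P (opn ω) ∨ P' (opn ω)} :=
  Percolation.harris_compl hF h.dependsOn h'.dependsOn h.isUpperSet h'.isUpperSet

end IncreasingOn

theorem increasingOn_conn {F : Set Edge} : IncreasingOn (fun O => Conn (O ∩ F) u v) F :=
  fun _ _ h hO => h.mono (Set.subset_inter hO Set.inter_subset_right)

theorem increasingOn_hcross : IncreasingOn (fun O => Hcross O a b c d) (inside (rect a b c d)) :=
  fun _ _ h hO => h.mono hO

theorem increasingOn_vcross : IncreasingOn (fun O => Vcross O a b c d) (inside (rect a b c d)) :=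
  fun _ _ h hO => h.mono hO

/-- A symmetry of the square lattice, acting on vertices and edges. -/
structure LatticeSymm where
  /-- The action on the vertices. -/
  vert : ℤ × ℤ → ℤ × ℤ
  /-- The action on the edges. -/
  edge : Edge ≃ Edge
  compat : ∀ e, (src (edge e) = vert (src e) ∧ tgt (edge e) = vert (tgt e)) ∨
    (src (edge e) = vert (tgt e) ∧ tgt (edge e) = vert (src e))

/-- The translation by `(s, t)`. -/
def shift (s t : ℤ) : LatticeSymm where
  vert z := (z.1 + s, z.2 + t)
  edge :=
    { toFun := fun e => ((e.1.1 + s, e.1.2 + t), e.2)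
      invFun := fun e => ((e.1.1 - s, e.1.2 - t), e.2)
      left_inv := fun e => by simp
      right_inv := fun e => by simp }
  compat := by
    rintro ⟨⟨x, y⟩, _ | _⟩ <;> left <;> simp <;> ring

/-- The reflection `(x, y) ↦ (s - x, y)`. -/
def reflX (s : ℤ) : LatticeSymm where
  vert z := (s - z.1, z.2)
  edge :=
    { toFun := fun e => if e.2 then ((s - e.1.1, e.1.2), true) else ((s - e.1.1 - 1, e.1.2), false)
      invFun := fun e => if e.2 then ((s - e.1.1, e.1.2), true) else ((s - e.1.1 - 1, e.1.2), false)
      left_inv := by rintro ⟨⟨x, y⟩, _ | _⟩ <;> simp; ring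
      right_inv := by rintro ⟨⟨x, y⟩, _ | _⟩ <;> simp; ring }
  compat := by
    rintro ⟨⟨x, y⟩, _ | _⟩
    · right; simp; ring
    · left; simp

/-- The reflection `(x, y) ↦ (y, x)`. -/
def transpose : LatticeSymm where
  vert z := (z.2, z.1)
  edge :=
    { toFun := fun e => ((e.1.2, e.1.1), !e.2)
      invFun := fun e => ((e.1.2, e.1.1), !e.2)
      left_inv := fun e => by simp
      right_inv := fun e => by simp }
  compat := by
    rintro ⟨⟨x, y⟩, _ | _⟩ <;> left <;> simp

/-- The reflection `(x, y) ↦ (x, s - y)`. -/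
def reflY (s : ℤ) : LatticeSymm where
  vert z := (z.1, s - z.2)
  edge :=
    { toFun := fun e => if e.2 then ((e.1.1, s - e.1.2 - 1), true) else ((e.1.1, s - e.1.2), false)
      invFun := fun e => if e.2 then ((e.1.1, s - e.1.2 - 1), true) else ((e.1.1, s - e.1.2), false)
      left_inv := by rintro ⟨⟨x, y⟩, _ | _⟩ <;> simp; ring
      right_inv := by rintro ⟨⟨x, y⟩, _ | _⟩ <;> simp; ring }
  compat := by
    rintro ⟨⟨x, y⟩, _ | _⟩
    · left; simp
    · right; simp; ring

theorem LatticeSymm.conn (φ : LatticeSymm) (h : ∀ e ∈ O, φ.edge e ∈ O') (huv : Conn O u v) :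
    Conn O' (φ.vert u) (φ.vert v) := by
  refine conn_map φ.vert (fun x y hs => Or.inr ?_) huv
  obtain ⟨e, he, hxy⟩ := hs
  refine ⟨φ.edge e, h e he, ?_⟩
  rcases hxy with ⟨rfl, rfl⟩ | ⟨rfl, rfl⟩
  · exact φ.compat e
  · exact (φ.compat e).symm

theorem LatticeSymm.edge_mem_inside (φ : LatticeSymm) (hS : ∀ z ∈ S, φ.vert z ∈ S')
    (he : e ∈ inside S) : φ.edge e ∈ inside S' := by
  rcases φ.compat e with ⟨h1, h2⟩ | ⟨h1, h2⟩
  · exact ⟨h1 ▸ hS _ he.1, h2 ▸ hS _ he.2⟩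
  · exact ⟨h1 ▸ hS _ he.2, h2 ▸ hS _ he.1⟩

theorem LatticeSymm.conn_inside (φ : LatticeSymm) (hS : ∀ z ∈ S, φ.vert z ∈ S')
    (huv : Conn (φ.edge ⁻¹' O ∩ inside S) u v) : Conn (O ∩ inside S') (φ.vert u) (φ.vert v) :=
  φ.conn (fun _ he => ⟨he.1, φ.edge_mem_inside hS he.2⟩) huv

/-- Bernoulli percolation is invariant under the symmetries of the lattice. -/
theorem LatticeSymm.prob_le (φ : LatticeSymm) (p : I) {P P' : Set Edge → Prop}
    (h : ∀ O, P (φ.edge ⁻¹' O) → P' O) :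
    (bern Edge p).real {ω | P (opn ω)} ≤ (bern Edge p).real {ω | P' (opn ω)} := by
  rw [← bern_real_relabel p φ.edge fun ω => P (opn ω)]
  exact measureReal_mono fun ω hω => h _ hω

/-! ### Crossing probabilities at the self-dual point -/

/-- The probability at `p = 1/2` that `[0, m] × [0, n]` is crossed from left to right. -/
noncomputable def crossProb (m n : ℤ) : ℝ :=
  (bern Edge half).real {ω | Hcross (opn ω) 0 m 0 n}

theorem hcross_shift (s t : ℤ) (h : Hcross ((shift s t).edge ⁻¹' O) a b c d) :
    Hcross O (a + s) (b + s) (c + t) (d + t) := by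
  obtain ⟨u, v, hu, hu', hv, hv', h⟩ := h
  have hS : ∀ z ∈ rect a b c d, (shift s t).vert z ∈ rect (a + s) (b + s) (c + t) (d + t) :=
    fun z hz => by simp only [mem_rect, shift] at *; omega
  exact ⟨_, _, hS u hu, by simp [shift, hu'], hS v hv, by simp [shift, hv'],
    LatticeSymm.conn_inside _ hS h⟩

theorem vcross_transpose (h : Vcross (transpose.edge ⁻¹' O) a b c d) : Hcross O c d a b := by
  obtain ⟨u, v, hu, hu', hv, hv', h⟩ := h
  have hS : ∀ z ∈ rect a b c d, transpose.vert z ∈ rect c d a b :=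
    fun z hz => by simp only [mem_rect, transpose] at *; omega
  exact ⟨_, _, hS u hu, hu', hS v hv, hv', LatticeSymm.conn_inside _ hS h⟩

theorem hcross_transpose (h : Hcross (transpose.edge ⁻¹' O) a b c d) : Vcross O c d a b := by
  obtain ⟨u, v, hu, hu', hv, hv', h⟩ := h
  have hS : ∀ z ∈ rect a b c d, transpose.vert z ∈ rect c d a b :=
    fun z hz => by simp only [mem_rect, transpose] at *; omega
  exact ⟨_, _, hS u hu, hu', hS v hv, hv', LatticeSymm.conn_inside _ hS h⟩

theorem prob_hcross (a b c d : ℤ) :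
    (bern Edge half).real {ω | Hcross (opn ω) a b c d} = crossProb (b - a) (d - c) := by
  apply le_antisymm
  · refine (shift (-a) (-c)).prob_le half (P := fun O => Hcross O a b c d)
      (P' := fun O => Hcross O 0 (b - a) 0 (d - c)) fun O h => ?_
    simpa [sub_eq_add_neg] using hcross_shift _ _ h
  · refine (shift a c).prob_le half (P := fun O => Hcross O 0 (b - a) 0 (d - c))
      (P' := fun O => Hcross O a b c d) fun O h => ?_
    simpa using hcross_shift _ _ h

theorem prob_vcross (a b c d : ℤ) :
    (bern Edge half).real {ω | Vcross (opn ω) a b c d} = crossProb (d - c) (b - a) := by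
  rw [← prob_hcross]
  exact le_antisymm
    (transpose.prob_le half (P := fun O => Vcross O a b c d) (P' := fun O => Hcross O c d a b)
      fun O h => vcross_transpose h)
    (transpose.prob_le half (P := fun O => Hcross O c d a b) (P' := fun O => Vcross O a b c d)
      fun O h => hcross_transpose h)

theorem crossProb_anti {m m' n : ℤ} (hm' : 0 ≤ m') (h : m' ≤ m) :
    crossProb m n ≤ crossProb m' n := by
  have := prob_hcross (m - m') m 0 n
  rw [sub_sub_cancel, sub_zero] at this
  rw [← this]
  exact measureReal_mono fun ω hω => hω.trim_left (by omega) (by omega)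

theorem crossProb_mono {m n n' : ℤ} (h : n ≤ n') : crossProb m n ≤ crossProb m n' :=
  measureReal_mono fun ω hω => hω.widen le_rfl h

/-- At `p = 1/2`, the closed dual edges have the same law as the open edges. -/
theorem prob_dual (P : Set Edge → Prop) :
    (bern Edge half).real {ω | P (dual (opn ω)ᶜ)} = (bern Edge half).real {ω | P (opn ω)} := by
  rw [← bern_real_flipAll fun ω => P (opn ω),
    ← bern_real_relabel half crossed fun ω => P (opn fun i => !ω i)]
  congr 1
  ext ω
  have : dual (opn ω)ᶜ = opn fun i => !ω (crossed i) := by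
    ext e
    simp [dual, opn]
  simp [this]

theorem half_le_crossProb_add_one {m : ℤ} (hm : 0 ≤ m) : 1 / 2 ≤ crossProb (m + 1) m := by
  have h1 := prob_vcross 0 m 0 (m + 1)
  have h2 := (prob_dual fun O => Hcross O (0 - 1) m 0 (m + 1 - 1)).trans (prob_hcross _ _ _ _)
  have h3 := measureReal_union_le (μ := bern Edge half) {ω | Vcross (opn ω) 0 m 0 (m + 1)}
    {ω | Hcross (dual (opn ω)ᶜ) (0 - 1) m 0 (m + 1 - 1)}
  have h4 : ({ω | Vcross (opn ω) 0 m 0 (m + 1)} ∪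
      {ω | Hcross (dual (opn ω)ᶜ) (0 - 1) m 0 (m + 1 - 1)}) = Set.univ := by
    ext ω
    simpa using vcross_or_hcross_dual (O := opn ω) (a := 0) (b := m) (c := 0) (d := m + 1)
      (by omega) hm
  rw [h4, h1, h2, probReal_univ] at h3
  simp only [sub_zero, add_sub_cancel_right, zero_sub, sub_neg_eq_add] at h3
  linarith

theorem half_le_crossProb_self {m : ℤ} (hm : 0 ≤ m) : 1 / 2 ≤ crossProb m m :=
  (half_le_crossProb_add_one hm).trans (crossProb_anti hm (by omega))

/-- The transposed form of `not_hcross_and_dual_vcross`. -/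
theorem not_vcross_and_dual_hcross (h : Vcross O a b c d)
    (h' : Hcross (dual Oᶜ) (a - 1) b c (d - 1)) : False := by
  have hinv : ∀ Q : Set Edge, transpose.edge ⁻¹' (transpose.edge ⁻¹' Q) = Q := fun Q => by
    ext e; simp [transpose]
  have hdual : dual (transpose.edge ⁻¹' O)ᶜ = transpose.edge ⁻¹' dual Oᶜ := by
    ext ⟨⟨x, y⟩, _ | _⟩ <;> simp [dual, transpose]
  refine not_hcross_and_dual_vcross (O := transpose.edge ⁻¹' O) disjoint_compl_right
    (vcross_transpose (by rwa [hinv])) (?_ : Vcross _ c (d - 1) (a - 1) b)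
  rw [hdual]
  exact hcross_transpose (by rwa [hinv])

/-! ### The Russo–Seymour–Welsh theorem -/

/-- The edges both of whose faces lie in `A`. -/
def bothIn (A : Set (ℤ × ℤ)) : Set Edge :=
  {e | src (crossed.symm e) ∈ A ∧ tgt (crossed.symm e) ∈ A}

theorem eq_of_incident {e : Edge} {z : ℤ × ℤ} (h : src e = z ∨ tgt e = z) :
    e = (z, false) ∨ e = ((z.1 - 1, z.2), false) ∨ e = (z, true) ∨
      e = ((z.1, z.2 - 1), true) := by
  obtain ⟨⟨x, y⟩, _ | _⟩ := e <;> rcases h with rfl | rfl <;> simp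

/-- A vertex touching a face of `A` is either surrounded by faces of `A` or an endpoint of an edge
of the interface. -/
theorem forall_mem_bothIn_or {A : Set (ℤ × ℤ)} {z : ℤ × ℤ}
    (he : src e = z ∨ tgt e = z) (heA : src (crossed.symm e) ∈ A ∨ tgt (crossed.symm e) ∈ A) :
    (∀ e', (src e' = z ∨ tgt e' = z) → e' ∈ bothIn A) ∨
      ∃ e' ∈ interface A, src e' = z ∨ tgt e' = z := by
  by_cases h : ∃ e' ∈ interface A, src e' = z ∨ tgt e' = z
  · exact Or.inr h
  · left
    push Not at h
    have h1 : (z, false) ∉ interface A := fun hm => (h _ hm).1 rfl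
    have h2 : ((z.1 - 1, z.2), false) ∉ interface A := fun hm => (h _ hm).2 (by simp)
    have h3 : (z, true) ∉ interface A := fun hm => (h _ hm).1 rfl
    have h4 : ((z.1, z.2 - 1), true) ∉ interface A := fun hm => (h _ hm).2 (by simp)
    simp only [interface, Set.mem_ofPred_eq, not_not, crossed_symm_true, crossed_symm_false,
      src_mk, tgt_true, tgt_false, sub_add_cancel, Prod.mk.eta] at h1 h2 h3 h4
    have hall : ∀ e', (src e' = z ∨ tgt e' = z) → (e' ∈ bothIn A ↔ z ∈ A) ∧
        ((src (crossed.symm e') ∈ A ∨ tgt (crossed.symm e') ∈ A) → z ∈ A) := by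
      intro e' he'
      rcases eq_of_incident he' with rfl | rfl | rfl | rfl <;>
        simp only [bothIn, Set.mem_ofPred_eq, crossed_symm_true, crossed_symm_false,
          src_mk, tgt_true, tgt_false, sub_add_cancel, Prod.mk.eta] <;> tauto
    exact fun e' he' => (hall e' he').1.2 ((hall e he).2 heA)

/-- A path from a vertex touching the complement of `A` to a vertex touching `A` contains, after
its last visit to the interface of `A`, a path of edges both of whose faces are in `A`. -/
theorem exists_last_interface {A : Set (ℤ × ℤ)} {F : Set Edge} (h : Conn (O ∩ F) u v)
    (hu : ∃ e, (src e = u ∨ tgt e = u) ∧ e ∉ bothIn A)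
    (hv : ∃ e, (src e = v ∨ tgt e = v) ∧ (src (crossed.symm e) ∈ A ∨ tgt (crossed.symm e) ∈ A)) :
    ∃ w, Conn (O ∩ F) u w ∧ (∃ e ∈ interface A, src e = w ∨ tgt e = w) ∧
      Conn (O ∩ (bothIn A ∩ F)) w v := by
  have key : (∃ w, Conn (O ∩ F) u w ∧ (∃ e ∈ interface A, src e = w ∨ tgt e = w) ∧
      Conn (O ∩ (bothIn A ∩ F)) w v) ∨ ((∀ e', (src e' = u ∨ tgt e' = u) → e' ∈ bothIn A) ∧
      Conn (O ∩ (bothIn A ∩ F)) u v) := by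
    clear hu
    induction h using Relation.ReflTransGen.head_induction_on with
    | refl =>
      obtain ⟨e, he, heA⟩ := hv
      rcases forall_mem_bothIn_or he heA with h | h
      · exact Or.inr ⟨h, Conn.refl⟩
      · exact Or.inl ⟨v, Conn.refl, h, Conn.refl⟩
    | @head x y hs _ ih =>
      have hxy : Conn (O ∩ F) x y := hs.conn
      rcases ih with ⟨w, hw, hw', hc⟩ | ⟨hy, hc⟩
      · exact Or.inl ⟨w, hxy.trans hw, hw', hc⟩
      obtain ⟨e, he, hxy⟩ := hs
      have heA : e ∈ bothIn A := hy e (by rcases hxy with h | h <;> tauto)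
      have hxv : Conn (O ∩ (bothIn A ∩ F)) x v :=
        Relation.ReflTransGen.head ⟨e, ⟨he.1, heA, he.2⟩, hxy⟩ hc
      rcases forall_mem_bothIn_or (z := x) (by rcases hxy with h | h <;> tauto)
        (Or.inl heA.1) with h | h
      · exact Or.inr ⟨h, hxv⟩
      · exact Or.inl ⟨x, Conn.refl, h, hxv⟩
  rcases key with h | ⟨h, -⟩
  · exact h
  · obtain ⟨e, he, heA⟩ := hu
    exact absurd (h e he) heA

/-- The union of the part of `C` below the axis `y = m + 1 / 2` and of its mirror image. -/
def symmetrize (m : ℤ) (C : Set (ℤ × ℤ)) : Set (ℤ × ℤ) :=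
  {z | (z.1, min z.2 (2 * m - z.2)) ∈ C}

/-- The square `[0, 2m + 1]²`, whose lower left quarter is `[0, m]²`. -/
def bigSquare (m : ℤ) : Set (ℤ × ℤ) := rect 0 (2 * m + 1) 0 (2 * m + 1)

/-- The right side of the square `[0, 2m + 1]²` is connected to the lower half of the interface of
`C` through the symmetrized set `C`. -/
def LowerArrival (m : ℤ) (C : Set (ℤ × ℤ)) (O : Set Edge) : Prop :=
  ∃ w v, w ∈ bigSquare m ∧ w.2 ≤ m ∧ v ∈ bigSquare m ∧ v.1 = 2 * m + 1 ∧
    (∃ e ∈ interface (symmetrize m C), src e = w ∨ tgt e = w) ∧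
    Conn (O ∩ (bothIn (symmetrize m C) ∩ inside (bigSquare m))) w v

theorem increasingOn_lowerArrival (m : ℤ) (C : Set (ℤ × ℤ)) :
    IncreasingOn (LowerArrival m C) (bothIn (symmetrize m C) ∩ inside (bigSquare m)) := by
  rintro O O' ⟨w, v, h1, h2, h3, h4, h5, h⟩ hO
  exact ⟨w, v, h1, h2, h3, h4, h5, increasingOn_conn h hO⟩

/-- The faces of the reflected edge are the reflected faces. -/
theorem reflY_faces (m : ℤ) (e : Edge) (C : Set (ℤ × ℤ)) :
    (src (crossed.symm ((reflY (2 * m + 1)).edge e)) ∈ symmetrize m C ↔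
      tgt (crossed.symm e) ∈ symmetrize m C ∧ e.2 = false ∨
      src (crossed.symm e) ∈ symmetrize m C ∧ e.2 = true) ∧
    (tgt (crossed.symm ((reflY (2 * m + 1)).edge e)) ∈ symmetrize m C ↔
      src (crossed.symm e) ∈ symmetrize m C ∧ e.2 = false ∨
      tgt (crossed.symm e) ∈ symmetrize m C ∧ e.2 = true) := by
  obtain ⟨⟨x, y⟩, _ | _⟩ := e <;>
    simp only [reflY, symmetrize, Equiv.coe_fn_mk, crossed_symm_true, crossed_symm_false,
      src_mk, tgt_true, tgt_false, Set.mem_ofPred_eq, if_true, if_false, Bool.false_eq_true,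
      and_true, and_false, false_or, or_false, Bool.true_eq_false]
  · constructor <;> (refine iff_of_eq (congrArg (· ∈ C) (Prod.ext rfl ?_)); simp only; omega)
  · constructor <;> (refine iff_of_eq (congrArg (· ∈ C) (Prod.ext rfl ?_)); simp only; omega)

theorem reflY_mem_interface (m : ℤ) {C : Set (ℤ × ℤ)} :
    (reflY (2 * m + 1)).edge e ∈ interface (symmetrize m C) ↔ e ∈ interface (symmetrize m C) := by
  obtain ⟨h1, h2⟩ := reflY_faces m e C
  simp only [interface, Set.mem_ofPred_eq, h1, h2]
  cases e.2 <;> simp; tauto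

theorem reflY_mem_bothIn (m : ℤ) {C : Set (ℤ × ℤ)} :
    (reflY (2 * m + 1)).edge e ∈ bothIn (symmetrize m C) ↔ e ∈ bothIn (symmetrize m C) := by
  obtain ⟨h1, h2⟩ := reflY_faces m e C
  simp only [bothIn, Set.mem_ofPred_eq, h1, h2]
  cases e.2 <;> simp; tauto

theorem reflY_reflY (s : ℤ) (O : Set Edge) :
    (reflY s).edge ⁻¹' ((reflY s).edge ⁻¹' O) = O := by
  ext e
  simp only [Set.mem_preimage]
  have : (reflY s).edge ((reflY s).edge e) = e := (reflY s).edge.left_inv e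
  rw [this]

/-- Every crossing of the big square arrives from the lower or from the upper half of the
symmetrized interface. -/
theorem lowerArrival_or {m : ℤ} (hm : 0 ≤ m) {C : Set (ℤ × ℤ)}
    (hL : ∀ z ∈ C, 0 ≤ z.1) (hR : ∀ z : ℤ × ℤ, m ≤ z.1 → z ∈ C)
    (h : Hcross O 0 (2 * m + 1) 0 (2 * m + 1)) :
    LowerArrival m C O ∨ LowerArrival m C ((reflY (2 * m + 1)).edge ⁻¹' O) := by
  obtain ⟨u, v, hu, hu', hv, hv', h⟩ := h
  obtain ⟨w, huw, hw, hwv⟩ := exists_last_interface (A := symmetrize m C) h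
    ⟨((u.1 - 1, u.2), false), by simp, fun hmem => by
      have := hL _ hmem.1
      simp only [crossed_symm_false, src_mk] at this
      omega⟩
    ⟨(v, true), by simp, Or.inl (hR _ (by simp; omega))⟩
  have hwR := huw.mem_inside hu
  rcases le_or_gt w.2 m with hwm | hwm
  · exact Or.inl ⟨w, v, hwR, hwm, hv, hv', hw, hwv⟩
  · right
    have hS : ∀ z ∈ bigSquare m, (reflY (2 * m + 1)).vert z ∈ bigSquare m := fun z hz => by
      simp only [bigSquare, mem_rect, reflY] at *; omega
    obtain ⟨e, he, hew⟩ := hw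
    refine ⟨_, _, hS w hwR, by simp only [reflY]; omega, hS v hv, hv',
      ⟨_, (reflY_mem_interface m).2 he, ?_⟩, ?_⟩
    · rcases (reflY (2 * m + 1)).compat e with ⟨h1, h2⟩ | ⟨h1, h2⟩ <;>
        rcases hew with rfl | rfl <;> tauto
    · refine (reflY (2 * m + 1)).conn (fun e he => ?_) hwv
      refine ⟨?_, (reflY_mem_bothIn m).2 he.2.1, LatticeSymm.edge_mem_inside _ hS he.2.2⟩
      change e ∈ (reflY (2 * m + 1)).edge ⁻¹' ((reflY (2 * m + 1)).edge ⁻¹' O)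
      rw [reflY_reflY]
      exact he.1

/-- Conditionally on the explored set, a crossing of the big square arrives from below with
probability at least `1 / 4`, since the two halves play symmetric roles. -/
theorem prob_lowerArrival {m : ℤ} (hm : 0 ≤ m) {C : Set (ℤ × ℤ)}
    (hL : ∀ z ∈ C, 0 ≤ z.1) (hR : ∀ z : ℤ × ℤ, m ≤ z.1 → z ∈ C) :
    1 / 4 ≤ (bern Edge half).real {ω | LowerArrival m C (opn ω)} := by
  have h1 := half_le_crossProb_self (m := 2 * m + 1) (by omega)
  have h2 : crossProb (2 * m + 1) (2 * m + 1) ≤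
      (bern Edge half).real {ω | LowerArrival m C (opn ω)} +
      (bern Edge half).real {ω | LowerArrival m C ((reflY (2 * m + 1)).edge ⁻¹' opn ω)} :=
    (measureReal_mono fun ω hω => lowerArrival_or hm hL hR hω).trans (measureReal_union_le _ _)
  have h3 := bern_real_relabel half (reflY (2 * m + 1)).edge fun ω => LowerArrival m C (opn ω)
  have h4 : (bern Edge half).real {ω | LowerArrival m C ((reflY (2 * m + 1)).edge ⁻¹' opn ω)} =
    (bern Edge half).real {ω | LowerArrival m C (opn ω)} := h3
  linarith

/-- There is a vertical crossing of `[0, m]²` which is connected in `[0, 2m + 1]²` to the right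
side of the latter. -/
def CrossAndArm (m : ℤ) (O : Set Edge) : Prop :=
  ∃ u v w, u ∈ rect 0 m 0 m ∧ u.2 = 0 ∧ v ∈ rect 0 m 0 m ∧ v.2 = m ∧
    Conn (O ∩ inside (rect 0 m 0 m)) u v ∧ w ∈ bigSquare m ∧ w.1 = 2 * m + 1 ∧
    Conn (O ∩ inside (bigSquare m)) u w

theorem rect_subset_bigSquare {m : ℤ} (hm : 0 ≤ m) : rect 0 m 0 m ⊆ bigSquare m :=
  rect_mono le_rfl (by omega) le_rfl (by omega)

theorem increasingOn_crossAndArm {m : ℤ} (hm : 0 ≤ m) :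
    IncreasingOn (CrossAndArm m) (inside (bigSquare m)) := by
  rintro O O' ⟨u, v, w, h1, h2, h3, h4, h5, h6, h7, h8⟩ hO
  refine ⟨u, v, w, h1, h2, h3, h4, ?_, h6, h7, increasingOn_conn h8 hO⟩
  exact (increasingOn_conn.mono_set (inside_mono (rect_subset_bigSquare hm))) h5 hO

theorem dependsOn_explored (a b c d : ℤ) :
    DependsOn (fun ω => explored (opn ω) a b c d) (inside (rect a b c d)) := by
  intro ω ω' h
  have : crossable (opn ω) a b c d = crossable (opn ω') a b c d := by
    simp only [crossable]
    congr 1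
    ext e
    simp only [Set.mem_inter_iff, Set.mem_compl_iff, opn, Set.mem_ofPred_eq]
    exact and_congr_left fun he => by rw [h e he]
  simp only [explored, this]

/-- The event that the explored set is `D` depends only on the edges touching `D`. -/
theorem dependsOn_explored_eq (a b c d : ℤ) (D : Set (ℤ × ℤ)) :
    DependsOn (fun ω => explored (opn ω) a b c d = D)
      ({e | src (crossed.symm e) ∈ D ∨ tgt (crossed.symm e) ∈ D} ∩ inside (rect a b c d)) := by
  have key : ∀ ω ω' : Edge → Bool, (∀ e ∈ {e | src (crossed.symm e) ∈ D ∨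
      tgt (crossed.symm e) ∈ D} ∩ inside (rect a b c d), ω e = ω' e) →
      explored (opn ω) a b c d = D → explored (opn ω') a b c d = D := by
    intro ω ω' h hD
    rw [← hD]
    refine reach_congr fun e he => ?_
    change src e ∈ explored (opn ω) a b c d ∨ tgt e ∈ explored (opn ω) a b c d at he
    rw [hD] at he
    simp only [dual, crossable, Set.mem_ofPred_eq, Set.mem_union, Set.mem_inter_iff,
      Set.mem_compl_iff, opn]
    refine or_congr_left (and_congr_left fun hin => ?_)
    rw [h (crossed e) ⟨by simpa using he, hin⟩]
  exact fun ω ω' h => propext ⟨key ω ω' h, key ω' ω fun e he => (h e he).symm⟩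

theorem prob_crossAndArm {m : ℤ} (hm : 1 ≤ m) :
    1 / 8 ≤ (bern Edge half).real {ω | CrossAndArm m (opn ω)} := by
  let Q : Set (ℤ × ℤ) → Prop := fun D => (∀ z ∈ D, z.1 < m) ∧ ∀ z : ℤ × ℤ, z.1 ≤ 0 - 1 → z ∈ D
  obtain ⟨R, hRQ, hsum, hdec⟩ := bern_real_decouple (p := half)
    (fun ω => explored (opn ω) 0 m 0 m) (finite_inside_rect 0 m 0 m) (dependsOn_explored 0 m 0 m) Q
    (fun D => {e | src (crossed.symm e) ∈ D ∨ tgt (crossed.symm e) ∈ D})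
    (dependsOn_explored_eq 0 m 0 m)
  have hprod := hdec (fun D => {ω | LowerArrival m (rightPart D m) (opn ω)})
    (fun D => bothIn (symmetrize m (rightPart D m)) ∩ inside (bigSquare m))
    (fun D _ => (finite_inside_rect _ _ _ _).subset Set.inter_subset_right)
    (fun D hD => by
      refine Set.disjoint_left.2 fun e he he' => ?_
      have hfold : ∀ z : ℤ × ℤ, z.2 ≤ m → z ∈ symmetrize m (rightPart D m) → z ∉ D := by
        intro z hz hmem
        have hz' : (z.1, min z.2 (2 * m - z.2)) = z := Prod.ext rfl (by simp only; omega)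
        simp only [symmetrize, Set.mem_ofPred_eq, hz'] at hmem
        exact notMem_of_mem_rightPart hD.1 hmem
      obtain ⟨hor, hin⟩ := he
      have h1 : (src (crossed.symm e)).2 ≤ m ∧ (tgt (crossed.symm e)).2 ≤ m := by
        obtain ⟨⟨x, y⟩, _ | _⟩ := e <;>
          simp only [inside, Set.mem_ofPred_eq, src_mk, tgt_true, tgt_false, mem_rect,
            crossed_symm_true, crossed_symm_false] at * <;> omega
      rcases hor with h | h
      · exact hfold _ h1.1 he'.1.1 h
      · exact hfold _ h1.2 he'.1.2 h)
    (fun D _ => (increasingOn_lowerArrival m _).dependsOn)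
  have hQ : 1 / 2 ≤ (bern Edge half).real {ω | Q (explored (opn ω) 0 m 0 m)} := by
    have h1 := prob_vcross 0 m 0 m
    rw [sub_zero] at h1
    refine (half_le_crossProb_self (m := m) (by omega)).trans (h1.symm.le.trans ?_)
    refine measureReal_mono fun ω hω => ⟨fun z hz => ?_, fun z hz => mem_explored_of_le hz⟩
    by_contra hzm
    exact not_vcross_and_dual_hcross hω
      (hcross_dual_of_explored (by omega) hz (by omega) (not_lt.1 hzm))
  have hQle : 1 / 4 * (bern Edge half).real {ω | Q (explored (opn ω) 0 m 0 m)} ≤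
      (bern Edge half).real {ω | Q (explored (opn ω) 0 m 0 m) ∧
        LowerArrival m (rightPart (explored (opn ω) 0 m 0 m) m) (opn ω)} := by
    refine le_trans ?_ hprod.symm.le
    rw [hsum, Finset.mul_sum]
    refine Finset.sum_le_sum fun D hD => ?_
    rw [mul_comm]
    refine mul_le_mul_of_nonneg_left ?_ measureReal_nonneg
    have hDQ := hRQ D hD
    refine prob_lowerArrival (by omega) (fun z hz => ?_) fun z hz => mem_rightPart_of_le hz
    by_contra hz0
    exact notMem_of_mem_rightPart hDQ.1 hz (hDQ.2 z (by omega))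
  have hsub : (bern Edge half).real {ω | Q (explored (opn ω) 0 m 0 m) ∧
        LowerArrival m (rightPart (explored (opn ω) 0 m 0 m) m) (opn ω)} ≤
      (bern Edge half).real {ω | CrossAndArm m (opn ω)} := by
    refine measureReal_mono ?_
    rintro ω ⟨hDQ, w, v, hw, hwm, hv, hv', ⟨e, he, hew⟩, hwv⟩
    obtain ⟨p, q, hp, hp', hq, hq', hpq, hall⟩ :=
      vcross_of_explored (O := opn ω) (a := 0) (b := m) (c := 0) (d := m) (by omega) hDQ.1
    have he' : e ∈ interface (rightPart (explored (opn ω) 0 m 0 m) m) := by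
      have hfold : ∀ z : ℤ × ℤ, z.2 ≤ m →
          (z ∈ symmetrize m (rightPart (explored (opn ω) 0 m 0 m) m) ↔
            z ∈ rightPart (explored (opn ω) 0 m 0 m) m) := by
        intro z hz
        have hz' : (z.1, min z.2 (2 * m - z.2)) = z := Prod.ext rfl (by simp only; omega)
        simp only [symmetrize, Set.mem_ofPred_eq, hz']
      have h1 : (src (crossed.symm e)).2 ≤ m ∧ (tgt (crossed.symm e)).2 ≤ m := by
        rcases eq_of_incident hew with rfl | rfl | rfl | rfl <;>
          simp only [crossed_symm_true, crossed_symm_false, src_mk, tgt_true, tgt_false] <;> omega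
      simpa only [interface, Set.mem_ofPred_eq, hfold _ h1.1, hfold _ h1.2] using he
    have hwS : w ∈ rect 0 m 0 m := by
      have hb := bounds_of_mem_interface hDQ.1 he'
      simp only [bigSquare, mem_rect] at hw ⊢
      rcases eq_of_incident hew with rfl | rfl | rfl | rfl
      · have := hb.1 rfl; simp only at this; omega
      · have := hb.1 rfl; simp only at this; omega
      · have := hb.2 rfl; simp only at this; omega
      · have := hb.2 rfl; simp only at this; omega
    refine ⟨p, q, v, hp, hp', hq, hq', hpq, hv, hv', ?_⟩
    have hpw := hall w hwS e he' hew
    refine (hpw.mono (Set.inter_subset_inter_right _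
      (inside_mono (rect_subset_bigSquare (by omega))))).trans
      (hwv.mono (Set.inter_subset_inter_right _ Set.inter_subset_right))
  linarith

theorem IncreasingOn.comp_symm {P : Set Edge → Prop} {F F' : Set Edge} (h : IncreasingOn P F)
    (φ : LatticeSymm) (hF : ∀ e ∈ F, φ.edge e ∈ F') :
    IncreasingOn (fun O => P (φ.edge ⁻¹' O)) F' :=
  fun _ _ hP hO => h hP fun e he => hO ⟨he.1, hF e he.2⟩

theorem LatticeSymm.prob_eq (φ : LatticeSymm) (p : I) (P : Set Edge → Prop) :
    (bern Edge p).real {ω | P (φ.edge ⁻¹' opn ω)} = (bern Edge p).real {ω | P (opn ω)} :=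
  bern_real_relabel p φ.edge fun ω => P (opn ω)

theorem reflX_reflX (s : ℤ) (O : Set Edge) :
    (reflX s).edge ⁻¹' ((reflX s).edge ⁻¹' O) = O := by
  ext e
  simp only [Set.mem_preimage]
  have : (reflX s).edge ((reflX s).edge e) = e := (reflX s).edge.left_inv e
  rw [this]

/-- A horizontal crossing of `[0, m]²` links a vertical crossing connected to the far right with
one connected to the far left. -/
theorem hcross_of_crossAndArm {m : ℤ} (hm : 0 ≤ m) (h : CrossAndArm m O)
    (h' : CrossAndArm m ((reflX m).edge ⁻¹' O)) (hH : Hcross O 0 m 0 m) :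
    Hcross O (-(m + 1)) (2 * m + 1) 0 (2 * m + 1) := by
  obtain ⟨p, q, hp, hp', hq, hq', hpq⟩ := hH
  obtain ⟨u, v, w, hu, hu', hv, hv', huv, hw, hw', huw⟩ := h
  obtain ⟨u₂, v₂, w₂, hu₂, hu₂', hv₂, hv₂', huv₂, hw₂, hw₂', huw₂⟩ := h'
  have hS : ∀ z ∈ rect 0 m 0 m, (reflX m).vert z ∈ rect 0 m 0 m := fun z hz => by
    simp only [mem_rect, reflX] at *; omega
  have hB : ∀ z ∈ bigSquare m, (reflX m).vert z ∈
      rect (-(m + 1)) (2 * m + 1) 0 (2 * m + 1) := fun z hz => by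
    simp only [bigSquare, mem_rect, reflX] at *; omega
  have hB' : bigSquare m ⊆ rect (-(m + 1)) (2 * m + 1) 0 (2 * m + 1) :=
    rect_mono (by omega) le_rfl le_rfl le_rfl
  have hSB := (rect_subset_bigSquare hm).trans hB'
  have lift : ∀ {x y}, Conn (O ∩ inside (rect 0 m 0 m)) x y →
      Conn (O ∩ inside (rect (-(m + 1)) (2 * m + 1) 0 (2 * m + 1))) x y :=
    fun h => h.mono (Set.inter_subset_inter_right _ (inside_mono hSB))
  obtain ⟨z, hz, hz'⟩ := exists_common_vertex hpq hp hp' hq hq' huv hu hu' hv'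
  obtain ⟨z₂, hz₂, hz₂'⟩ := exists_common_vertex hpq hp hp' hq hq'
    ((reflX m).conn_inside hS huv₂) (hS _ hu₂) hu₂' hv₂'
  refine ⟨_, w, hB w₂ hw₂, by simp only [reflX, hw₂']; ring, hB' hw, hw', ?_⟩
  have h1 := (reflX m).conn_inside hB huw₂
  have h2 := huw.mono (Set.inter_subset_inter_right O (inside_mono hB'))
  exact h1.symm.trans ((lift hz₂').trans ((lift hz₂).symm.trans ((lift hz).trans
    ((lift hz').symm.trans h2))))

/-- Two overlapping horizontal crossings are linked by a vertical crossing of the overlap. -/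
theorem hcross_glue (h₁ : Hcross O a b c d) (h₂ : Hcross O a' b' c d) (h : Vcross O a' b c d)
    (ha : a ≤ a') (hb : b ≤ b') : Hcross O a b' c d := by
  obtain ⟨p, q, hp, hp', hq, hq', hpq⟩ := h₁
  obtain ⟨r, s, hr, hr', hs, hs', hrs⟩ := h₂
  obtain ⟨u, v, hu, hu', hv, hv', huv⟩ := h
  have i1 : rect a' b c d ⊆ rect a b c d := rect_mono ha le_rfl le_rfl le_rfl
  have i2 : rect a' b c d ⊆ rect a' b' c d := rect_mono le_rfl hb le_rfl le_rfl
  have j1 : rect a b c d ⊆ rect a b' c d := rect_mono le_rfl hb le_rfl le_rfl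
  have j2 : rect a' b' c d ⊆ rect a b' c d := rect_mono ha le_rfl le_rfl le_rfl
  have lift : ∀ {R R' : Set (ℤ × ℤ)} {x y}, R ⊆ R' → Conn (O ∩ inside R) x y →
      Conn (O ∩ inside R') x y :=
    fun hR h => h.mono (Set.inter_subset_inter_right _ (inside_mono hR))
  obtain ⟨z, hz, hz'⟩ := exists_common_vertex hpq hp hp' hq hq' (lift i1 huv) (i1 hu) hu' hv'
  obtain ⟨y, hy, hy'⟩ := exists_common_vertex hrs hr hr' hs hs' (lift i2 huv) (i2 hu) hu' hv'
  exact ⟨p, s, j1 hp, hp', j2 hs, hs', (lift j1 hz).trans ((lift j1 hz').symm.trans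
    ((lift j2 hy').trans ((lift j2 hy).symm.trans (lift j2 hrs))))⟩

/-- Crossings of `3 : 2` rectangles have probability bounded below. -/
theorem crossProb_three_halves {m : ℤ} (hm : 1 ≤ m) :
    1 / 128 ≤ crossProb (3 * m + 2) (2 * m + 1) := by
  have hF := finite_inside_rect (-(m + 1)) (2 * m + 1) 0 (2 * m + 1)
  have i1 : IncreasingOn (CrossAndArm m) (inside (rect (-(m + 1)) (2 * m + 1) 0 (2 * m + 1))) :=
    (increasingOn_crossAndArm (by omega)).mono_set
      (inside_mono (rect_mono (by omega) le_rfl le_rfl le_rfl))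
  have i2 : IncreasingOn (fun O => CrossAndArm m ((reflX m).edge ⁻¹' O))
      (inside (rect (-(m + 1)) (2 * m + 1) 0 (2 * m + 1))) :=
    (increasingOn_crossAndArm (by omega)).comp_symm _ fun e he =>
      LatticeSymm.edge_mem_inside _ (fun z hz => by
        simp only [bigSquare, mem_rect, reflX] at *; omega) he
  have i3 : IncreasingOn (fun O => Hcross O 0 m 0 m)
      (inside (rect (-(m + 1)) (2 * m + 1) 0 (2 * m + 1))) :=
    increasingOn_hcross.mono_set
      (inside_mono (rect_mono (by omega) (by omega) le_rfl (by omega)))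
  have h1 := prob_crossAndArm hm
  have h2 := (reflX m).prob_eq half (CrossAndArm m)
  have h3 := half_le_crossProb_self (m := m) (by omega)
  have h12 := i1.harris i2 hF half
  have h123 := (i1.and i2).harris i3 hF half
  have hsub : (bern Edge half).real {ω | (CrossAndArm m (opn ω) ∧
      CrossAndArm m ((reflX m).edge ⁻¹' opn ω)) ∧ Hcross (opn ω) 0 m 0 m} ≤
      (bern Edge half).real {ω | Hcross (opn ω) (-(m + 1)) (2 * m + 1) 0 (2 * m + 1)} :=
    measureReal_mono fun ω hω => hcross_of_crossAndArm (by omega) hω.1.1 hω.1.2 hω.2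
  rw [prob_hcross, show 2 * m + 1 - -(m + 1) = 3 * m + 2 by ring, sub_zero] at hsub
  refine le_trans ?_ (h123.trans hsub)
  rw [h2] at h12
  have h4 : (1 : ℝ) / 64 ≤ (bern Edge half).real {ω | (CrossAndArm m (opn ω) ∧
      CrossAndArm m ((reflX m).edge ⁻¹' opn ω))} := by
    refine le_trans ?_ h12
    calc (1 : ℝ) / 64 = 1 / 8 * (1 / 8) := by norm_num
      _ ≤ _ := mul_le_mul h1 h1 (by norm_num) measureReal_nonneg
  calc (1 : ℝ) / 128 = 1 / 64 * (1 / 2) := by norm_num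
    _ ≤ _ := mul_le_mul h4 h3 (by norm_num) measureReal_nonneg

/-- Crossings of arbitrarily long rectangles have probability bounded below, uniformly in the
scale. -/
theorem crossProb_long {m : ℤ} (hm : 1 ≤ m) (k : ℕ) :
    (1 / 256 : ℝ) ^ (k + 1) ≤ crossProb (3 * m + 2 + k * (m + 1)) (2 * m + 1) := by
  have hx := crossProb_three_halves hm
  induction k with
  | zero =>
    simp only [zero_add, pow_one, Nat.cast_zero, zero_mul, add_zero]
    linarith
  | succ k ih =>
    set ℓ : ℤ := 3 * m + 2 + k * (m + 1) with hℓ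
    have hkm : (0 : ℤ) ≤ k * (m + 1) := by positivity
    have hF := finite_inside_rect 0 (ℓ + (m + 1)) 0 (2 * m + 1)
    have i1 : IncreasingOn (fun O => Hcross O 0 ℓ 0 (2 * m + 1))
        (inside (rect 0 (ℓ + (m + 1)) 0 (2 * m + 1))) :=
      increasingOn_hcross.mono_set (inside_mono (rect_mono le_rfl (by omega) le_rfl le_rfl))
    have i2 : IncreasingOn (fun O => Hcross O (ℓ - (2 * m + 1)) (ℓ + (m + 1)) 0 (2 * m + 1))
        (inside (rect 0 (ℓ + (m + 1)) 0 (2 * m + 1))) :=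
      increasingOn_hcross.mono_set (inside_mono (rect_mono (by omega) le_rfl le_rfl le_rfl))
    have i3 : IncreasingOn (fun O => Vcross O (ℓ - (2 * m + 1)) ℓ 0 (2 * m + 1))
        (inside (rect 0 (ℓ + (m + 1)) 0 (2 * m + 1))) :=
      increasingOn_vcross.mono_set (inside_mono (rect_mono (by omega) (by omega) le_rfl le_rfl))
    have h1 : (1 / 256 : ℝ) ^ (k + 1) ≤
      (bern Edge half).real {ω | Hcross (opn ω) 0 ℓ 0 (2 * m + 1)} := ih
    have h2 := prob_hcross (ℓ - (2 * m + 1)) (ℓ + (m + 1)) 0 (2 * m + 1)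
    rw [show ℓ + (m + 1) - (ℓ - (2 * m + 1)) = 3 * m + 2 by ring, sub_zero] at h2
    have h3 := prob_vcross (ℓ - (2 * m + 1)) ℓ 0 (2 * m + 1)
    rw [sub_sub_cancel, sub_zero] at h3
    have h4 := half_le_crossProb_self (m := 2 * m + 1) (by omega)
    have h12 := i1.harris i2 hF half
    have h123 := (i1.and i2).harris i3 hF half
    have hsub : (bern Edge half).real {ω | (Hcross (opn ω) 0 ℓ 0 (2 * m + 1) ∧
        Hcross (opn ω) (ℓ - (2 * m + 1)) (ℓ + (m + 1)) 0 (2 * m + 1)) ∧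
        Vcross (opn ω) (ℓ - (2 * m + 1)) ℓ 0 (2 * m + 1)} ≤ crossProb (ℓ + (m + 1)) (2 * m + 1) :=
      measureReal_mono fun ω hω => hcross_glue hω.1.1 hω.1.2 hω.2 (by omega) (by omega)
    have hgoal : 3 * m + 2 + ((k + 1 : ℕ) : ℤ) * (m + 1) = ℓ + (m + 1) := by
      rw [hℓ]; push_cast; ring
    rw [hgoal]
    refine le_trans ?_ (h123.trans hsub)
    rw [h2] at h12
    rw [h3]
    calc (1 / 256 : ℝ) ^ (k + 1 + 1) = ((1 / 256) ^ (k + 1) * (1 / 128)) * (1 / 2) := by ring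
      _ ≤ _ := mul_le_mul ((mul_le_mul h1 hx (by norm_num) measureReal_nonneg).trans h12) h4
        (by norm_num) measureReal_nonneg

/-! ### One-arm events -/

/-- The box of radius `n` centred at `x`. -/
def ball (x : ℤ × ℤ) (n : ℤ) : Set (ℤ × ℤ) := rect (x.1 - n) (x.1 + n) (x.2 - n) (x.2 + n)

@[simp] theorem mem_ball {x z : ℤ × ℤ} {n : ℤ} :
    z ∈ ball x n ↔ x.1 - n ≤ z.1 ∧ z.1 ≤ x.1 + n ∧ x.2 - n ≤ z.2 ∧ z.2 ≤ x.2 + n := Iff.rfl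

theorem finite_inside_ball (x : ℤ × ℤ) (n : ℤ) : (inside (ball x n)).Finite :=
  finite_inside_rect _ _ _ _

/-- `v` is not in the interior of the box of radius `n` centred at `x`. -/
def Far (x : ℤ × ℤ) (n : ℤ) (v : ℤ × ℤ) : Prop :=
  v.1 ≤ x.1 - n ∨ x.1 + n ≤ v.1 ∨ v.2 ≤ x.2 - n ∨ x.2 + n ≤ v.2

/-- `x` is connected to the boundary of the box of radius `n` centred at `x` inside this box. -/
def Arm (x : ℤ × ℤ) (n : ℤ) (O : Set Edge) : Prop :=
  ∃ v ∈ ball x n, Far x n v ∧ Conn (O ∩ inside (ball x n)) x v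

theorem increasingOn_arm (x : ℤ × ℤ) (n : ℤ) : IncreasingOn (Arm x n) (inside (ball x n)) := by
  rintro O O' ⟨v, hv, hv', h⟩ hO
  exact ⟨v, hv, hv', increasingOn_conn h hO⟩

theorem arm_of_conn {x z : ℤ × ℤ} {n : ℤ} (hn : 0 ≤ n) (h : Conn O x z) (hz : Far x n z) :
    Arm x n O := by
  suffices key : Arm x n O ∨ (¬ Far x n z ∧ Conn (O ∩ inside (ball x n)) x z) by tauto
  clear hz
  have hx : x ∈ ball x n := by simp only [mem_ball]; omega
  induction h with
  | refl =>
    by_cases hF : Far x n x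
    · exact Or.inl ⟨x, hx, hF, Conn.refl⟩
    · exact Or.inr ⟨hF, Conn.refl⟩
  | @tail y z _ hs ih =>
    rcases ih with h | ⟨hy, hc⟩
    · exact Or.inl h
    have hyz : y ∈ ball x n ∧ z ∈ ball x n := by
      simp only [Far, not_or, not_le, mem_ball] at *
      rcases step_iff.1 hs with ⟨h, -⟩ | ⟨h, -⟩ | ⟨h, -⟩ | ⟨h, -⟩ <;>
        rw [Prod.ext_iff] at h <;> simp only at h <;> omega
    have hxz := hc.trans (hs.inside hyz.1 hyz.2).conn
    by_cases hF : Far x n z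
    · exact Or.inl ⟨z, hyz.2, hF, hxz⟩
    · exact Or.inr ⟨hF, hxz⟩

theorem Arm.mono {x : ℤ × ℤ} {n n' : ℤ} (hn' : 0 ≤ n') (h : n' ≤ n) (hA : Arm x n O) :
    Arm x n' O := by
  obtain ⟨v, -, hv, hc⟩ := hA
  exact arm_of_conn hn' (hc.mono Set.inter_subset_left) (by simp only [Far] at *; omega)

/-- The probability that the origin is connected to the boundary of the box of radius `n`. -/
noncomputable def armProb (p : I) (n : ℤ) : ℝ := (bern Edge p).real {ω | Arm 0 n (opn ω)}

theorem armProb_anti (p : I) {n n' : ℤ} (hn' : 0 ≤ n') (h : n' ≤ n) :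
    armProb p n ≤ armProb p n' :=
  measureReal_mono fun _ hω => Arm.mono hn' h hω

theorem prob_arm_le (p : I) (x : ℤ × ℤ) (n : ℤ) :
    (bern Edge p).real {ω | Arm x n (opn ω)} ≤ armProb p n := by
  refine (shift (-x.1) (-x.2)).prob_le p (P := Arm x n) (P' := Arm 0 n) ?_
  rintro O ⟨v, hv, hv', h⟩
  have hS : ∀ z ∈ ball x n, (shift (-x.1) (-x.2)).vert z ∈ ball 0 n := fun z hz => by
    simp only [mem_ball, shift, Prod.fst_zero, Prod.snd_zero] at *; omega
  have h0 : (shift (-x.1) (-x.2)).vert x = 0 := by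
    simp [shift, Prod.ext_iff]
  have hc := LatticeSymm.conn_inside _ hS h
  rw [h0] at hc
  refine ⟨_, hS v hv, ?_, hc⟩
  simp only [Far, shift, Prod.fst_zero, Prod.snd_zero] at *; omega

/-- The lower bound on the one-arm probability: one of the `n` vertices on the left side of
`[0, n] × [0, n - 1]` is the endpoint of an arm as soon as this rectangle is crossed. -/
theorem half_div_le_armProb {n : ℕ} (hn : 1 ≤ n) :
    (1 / 2 : ℝ) * (n : ℝ)⁻¹ ≤ armProb half n := by
  have h1 := half_le_crossProb_add_one (m := (n : ℤ) - 1) (by omega)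
  rw [sub_add_cancel] at h1
  have h2 : crossProb n (n - 1) ≤ ∑ y ∈ Finset.range n,
      (bern Edge half).real {ω | Arm ((0 : ℤ), (y : ℤ)) n (opn ω)} := by
    refine le_trans (measureReal_mono ?_ (measure_ne_top _ _)) (measureReal_biUnion_finset_le _ _)
    rintro ω ⟨u, v, hu, hu', hv, hv', h⟩
    simp only [mem_rect] at hu
    simp only [Set.mem_iUnion, Finset.mem_range, Set.mem_ofPred_eq]
    refine ⟨u.2.toNat, by omega, ?_⟩
    have hu2 : ((0 : ℤ), (u.2.toNat : ℤ)) = u := Prod.ext hu'.symm (by simp only; omega)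
    rw [hu2]
    exact arm_of_conn (by omega) (h.mono Set.inter_subset_left)
      (Or.inr (Or.inl (by omega)))
  have h3 : ∑ y ∈ Finset.range n,
      (bern Edge half).real {ω | Arm ((0 : ℤ), (y : ℤ)) n (opn ω)} ≤ n * armProb half n := by
    refine (Finset.sum_le_sum fun y _ => prob_arm_le half _ _).trans ?_
    simp
  have hn0 : (0 : ℝ) < n := by exact_mod_cast hn
  rw [← div_eq_mul_inv, div_le_iff₀ hn0]
  linarith

/-- The rectangle between the boxes of radii `N` and `L`, on the right or on the left of the inner
one, is crossed from the inside to the outside. -/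
def SideCross (N L : ℤ) (O : Set Edge) : Prop :=
  Hcross O (N + 1) L (-L) L ∨ Hcross ((reflX 0).edge ⁻¹' O) (N + 1) L (-L) L

/-- One of the four rectangles between the boxes of radii `N` and `L` is crossed from the inside
to the outside. -/
def AnnulusCross (N L : ℤ) (O : Set Edge) : Prop :=
  SideCross N L O ∨ SideCross N L (transpose.edge ⁻¹' O)

theorem annulusCross_of_arm {N L : ℤ} (hN : 0 ≤ N) (hNL : N + 1 ≤ L) (h : Arm 0 L O) :
    AnnulusCross N L O := by
  -- an arm ending on the right side yields a crossing of the rectangle on the right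
  have hright : ∀ {O : Set Edge} {v : ℤ × ℤ}, v ∈ ball 0 L → v.1 = L →
      Conn (O ∩ inside (ball 0 L)) 0 v → Hcross O (N + 1) L (-L) L := by
    intro O v hv hvL h
    have hb : ball 0 L = rect (-L) L (-L) L := by
      ext z; simp
    rw [hb] at h hv
    exact hcross_of_conn h hv hvL (by simp; omega) hNL
  have hside : ∀ {O : Set Edge} {v : ℤ × ℤ}, v ∈ ball 0 L → (v.1 = L ∨ v.1 = -L) →
      Conn (O ∩ inside (ball 0 L)) 0 v → SideCross N L O := by
    intro O v hv hvL h
    rcases hvL with hvL | hvL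
    · exact Or.inl (hright hv hvL h)
    · right
      have hS : ∀ z ∈ ball 0 L, (reflX 0).vert z ∈ ball 0 L := fun z hz => by
        simp only [mem_ball, reflX, Prod.fst_zero, Prod.snd_zero] at *; omega
      rw [← reflX_reflX 0 O] at h
      have hc := LatticeSymm.conn_inside _ hS h
      have h0 : (reflX 0).vert 0 = 0 := by simp [reflX]
      rw [h0] at hc
      exact hright (hS v hv) (by simp [reflX, hvL]) hc
  obtain ⟨v, hv, hv', h⟩ := h
  by_cases h1 : v.1 = L ∨ v.1 = -L
  · exact Or.inl (hside hv h1 h)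
  · right
    have hS : ∀ z ∈ ball 0 L, transpose.vert z ∈ ball 0 L := fun z hz => by
      simp only [mem_ball, transpose, Prod.fst_zero, Prod.snd_zero] at *; omega
    have hT : transpose.edge ⁻¹' (transpose.edge ⁻¹' O) = O := by
      ext e; simp [transpose]
    rw [← hT] at h
    have hc := LatticeSymm.conn_inside _ hS h
    have h0 : transpose.vert 0 = 0 := rfl
    rw [h0] at hc
    refine hside (hS v hv) ?_ hc
    simp only [mem_ball, transpose, Far, Prod.fst_zero, Prod.snd_zero] at *; omega

theorem increasingOn_sideCross {N L : ℤ} (hN : 0 ≤ N) :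
    IncreasingOn (SideCross N L) (inside (ball 0 L \ ball 0 N)) := by
  have h : rect (N + 1) L (-L) L ⊆ ball 0 L \ ball 0 N := fun z hz => by
    simp only [mem_rect, Set.mem_sdiff, mem_ball, Prod.fst_zero, Prod.snd_zero] at *; omega
  refine (increasingOn_hcross.mono_set (inside_mono h)).or (increasingOn_hcross.comp_symm _
    fun e he => LatticeSymm.edge_mem_inside _ (fun z hz => ?_) he)
  simp only [mem_rect, Set.mem_sdiff, mem_ball, Prod.fst_zero, Prod.snd_zero, reflX] at *; omega

theorem increasingOn_annulusCross {N L : ℤ} (hN : 0 ≤ N) :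
    IncreasingOn (AnnulusCross N L) (inside (ball 0 L \ ball 0 N)) := by
  refine (increasingOn_sideCross hN).or ((increasingOn_sideCross hN).comp_symm _
    fun e he => LatticeSymm.edge_mem_inside _ (fun z hz => ?_) he)
  simp only [Set.mem_sdiff, mem_ball, Prod.fst_zero, Prod.snd_zero, transpose] at *; omega

/-- The annulus between the boxes of radii `N` and `3N + 3` is not crossed with probability
bounded below: each of the four rectangles can be blocked by a long dual crossing. -/
theorem prob_annulusCross_le {N : ℤ} (hN : 1 ≤ N) :
    (bern Edge half).real {ω | AnnulusCross N (3 * N + 3) (opn ω)} ≤ 1 - (1 / 256) ^ 32 := by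
  set L := 3 * N + 3 with hL
  have hF : (inside (ball 0 L \ ball 0 N)).Finite :=
    finite_inside ((finite_rect _ _ _ _).subset Set.sdiff_subset)
  set r := (bern Edge half).real {ω | Hcross (opn ω) (N + 1) L (-L) L} with hr
  have hblock : r + crossProb (2 * L + 1) (L - N - 2) ≤ 1 := by
    have h1 := (prob_dual fun O => Vcross O (N + 1) (L - 1) (-L - 1) L).trans
      (prob_vcross _ _ _ _)
    rw [show L - (-L - 1) = 2 * L + 1 by ring, show L - 1 - (N + 1) = L - N - 2 by ring] at h1
    rw [← h1, hr]
    have hmeas : MeasurableSet {ω | Hcross (opn ω) (N + 1) L (-L) L} :=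
      measurableSet_of_dependsOn (finite_inside_rect _ _ _ _) increasingOn_hcross.dependsOn
    have hdisj : Disjoint {ω | Hcross (opn ω) (N + 1) L (-L) L}
        {ω | Vcross (dual (opn ω)ᶜ) (N + 1) (L - 1) (-L - 1) L} :=
      Set.disjoint_left.2 fun ω h h' => not_hcross_and_dual_vcross disjoint_compl_right h h'
    rw [← measureReal_union' hdisj hmeas]
    exact measureReal_le_one
  have hlong : (1 / 256 : ℝ) ^ 8 ≤ crossProb (2 * L + 1) (L - N - 2) := by
    refine (crossProb_long hN 7).trans ((crossProb_anti (by omega) ?_).trans (crossProb_mono ?_))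
    · push_cast; omega
    · omega
  have hr1 : (1 / 256 : ℝ) ^ 8 ≤ 1 - r := by linarith
  have hrect : rect (N + 1) L (-L) L ⊆ ball 0 L := fun z hz => by
    simp only [mem_rect, mem_ball, Prod.fst_zero, Prod.snd_zero] at *; omega
  have i1 : IncreasingOn (fun O => Hcross O (N + 1) L (-L) L) (inside (ball 0 L)) :=
    increasingOn_hcross.mono_set (inside_mono hrect)
  have i2 : IncreasingOn (fun O => Hcross ((reflX 0).edge ⁻¹' O) (N + 1) L (-L) L)
      (inside (ball 0 L)) :=
    i1.comp_symm _ fun e he => LatticeSymm.edge_mem_inside _ (fun z hz => by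
      simp only [mem_ball, Prod.fst_zero, Prod.snd_zero, reflX] at *; omega) he
  have i3 : IncreasingOn (SideCross N L) (inside (ball 0 L)) := i1.or i2
  have i4 : IncreasingOn (fun O => SideCross N L (transpose.edge ⁻¹' O)) (inside (ball 0 L)) :=
    i3.comp_symm _ fun e he => LatticeSymm.edge_mem_inside _ (fun z hz => by
      simp only [mem_ball, Prod.fst_zero, Prod.snd_zero, transpose] at *; omega) he
  have h12 := i1.harris_compl i2 (finite_inside_ball 0 L) half
  have h34 := i3.harris_compl i4 (finite_inside_ball 0 L) half
  rw [(reflX 0).prob_eq half fun O => Hcross O (N + 1) L (-L) L, ← hr] at h12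
  rw [transpose.prob_eq half (SideCross N L)] at h34
  have h12' : (1 / 256 : ℝ) ^ 16 ≤ 1 - (bern Edge half).real {ω | SideCross N L (opn ω)} := by
    refine le_trans ?_ h12
    calc (1 / 256 : ℝ) ^ 16 = (1 / 256) ^ 8 * (1 / 256) ^ 8 := by ring
      _ ≤ _ := mul_le_mul hr1 hr1 (by positivity) (le_trans (by positivity) hr1)
  have h34' : (1 / 256 : ℝ) ^ 32 ≤ 1 - (bern Edge half).real {ω | AnnulusCross N L (opn ω)} := by
    refine le_trans ?_ h34
    calc (1 / 256 : ℝ) ^ 32 = (1 / 256) ^ 16 * (1 / 256) ^ 16 := by ring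
      _ ≤ _ := mul_le_mul h12' h12' (by positivity) (le_trans (by positivity) h12')
  linarith

theorem armProb_annulus {N : ℤ} (hN : 1 ≤ N) :
    armProb half (3 * N + 3) ≤ armProb half N * (1 - (1 / 256) ^ 32) := by
  have hind := bern_real_inter_of_disjoint (p := half) (finite_inside_ball 0 N)
    (finite_inside ((finite_rect _ _ _ _).subset Set.sdiff_subset))
    (Set.disjoint_left.2 fun e (he : e ∈ inside (ball 0 N))
      (he' : e ∈ inside (ball 0 (3 * N + 3) \ ball 0 N)) => he'.1.2 he.1)
    (increasingOn_arm 0 N).dependsOn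
    (increasingOn_annulusCross (N := N) (L := 3 * N + 3) (by omega)).dependsOn
  refine le_trans (measureReal_mono fun ω hω => ?_) (hind.le.trans
    (mul_le_mul_of_nonneg_left (prob_annulusCross_le hN) measureReal_nonneg))
  exact ⟨Arm.mono (by omega) (by omega) hω, annulusCross_of_arm (by omega) (by omega) hω⟩

theorem prob_mem_opn (p : I) (e : Edge) : (bern Edge p).real {ω | e ∈ opn ω} = p := by
  have h := measurePreserving_eval_infinitePi (fun _ : Edge => bernoulliMeasure true false p) e
  have h2 := h.measureReal_preimage (s := {true}) (measurableSet_singleton _).nullMeasurableSet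
  rw [bernoulliMeasure_real_singleton] at h2
  have h3 : wt p true = p := by simp [wt]
  rw [h3] at h2
  exact h2

/-- With positive probability the four edges at the origin are closed. -/
theorem armProb_one_le : armProb half 1 ≤ 15 / 16 := by
  let F : Set Edge := {((-1, 0), false), (0, true), ((0, -1), true), (0, false)}
  have i : ∀ e ∈ F, IncreasingOn (fun O => e ∈ O) F := fun e he O O' h hO => hO ⟨h, he⟩
  have hF : F.Finite := Set.toFinite _
  have i1 := i ((-1, 0), false) (by simp [F])
  have i2 := i (0, true) (by simp [F])
  have i3 := i ((0, -1), true) (by simp [F])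
  have i4 := i (0, false) (by simp [F])
  have h12 := i1.harris_compl i2 hF half
  have h34 := i3.harris_compl i4 hF half
  have h := (i1.or i2).harris_compl (i3.or i4) hF half
  simp only [prob_mem_opn] at h12 h34
  have hh : (half : ℝ) = 1 / 2 := rfl
  rw [hh] at h12 h34
  have hsub : armProb half 1 ≤ (bern Edge half).real {ω | (((-1, 0), false) ∈ opn ω ∨
      (0, true) ∈ opn ω) ∨ ((0, -1), true) ∈ opn ω ∨ (0, false) ∈ opn ω} := by
    refine measureReal_mono ?_
    rintro ω ⟨v, -, hv, hc⟩
    rcases Relation.ReflTransGen.cases_head hc with rfl | ⟨z, hz, -⟩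
    · simp [Far] at hv
    · have hz' := hz.mono Set.inter_subset_left
      rcases step_iff.1 hz' with ⟨-, h⟩ | ⟨h, h'⟩ | ⟨-, h⟩ | ⟨h, h'⟩
      · exact Or.inr (Or.inr h)
      · have : z = (-1, 0) := by
          simp only [Prod.ext_iff, Prod.fst_zero, Prod.snd_zero] at h ⊢; omega
        exact Or.inl (Or.inl (this ▸ h'))
      · exact Or.inl (Or.inr h)
      · have : z = (0, -1) := by
          simp only [Prod.ext_iff, Prod.fst_zero, Prod.snd_zero] at h ⊢; omega
        exact Or.inr (Or.inl (this ▸ h'))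
  nlinarith

theorem exists_armProb_geometric : ∃ q : ℝ, 0 < q ∧ q < 1 ∧
    ∀ k : ℕ, armProb half (6 ^ k) ≤ q ^ (k + 1) := by
  refine ⟨1 - (1 / 256) ^ 32, by norm_num, by norm_num, fun k => ?_⟩
  have h1 : armProb half 1 ≤ 1 - (1 / 256) ^ 32 := armProb_one_le.trans (by norm_num)
  induction k with
  | zero => simpa using h1
  | succ k ih =>
    have hk : (1 : ℤ) ≤ 6 ^ k := one_le_pow₀ (by norm_num)
    calc armProb half (6 ^ (k + 1)) ≤ armProb half (3 * 6 ^ k + 3) :=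
          armProb_anti half (by positivity) (by rw [pow_succ]; omega)
      _ ≤ _ := armProb_annulus hk
      _ ≤ (1 - (1 / 256) ^ 32) ^ (k + 1) * (1 - (1 / 256) ^ 32) :=
          mul_le_mul_of_nonneg_right ih (by norm_num)
      _ = _ := (pow_succ _ _).symm

/-- Polynomial decay of the one-arm probability at `p = 1/2`. -/
theorem exists_armProb_le_rpow : ∃ α : ℝ, 0 < α ∧ ∀ n : ℕ, 1 ≤ n →
    armProb half n ≤ (n : ℝ) ^ (-α) := by
  obtain ⟨q, hq0, hq1, hq⟩ := exists_armProb_geometric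
  have hl6 : 0 < Real.log 6 := Real.log_pos (by norm_num)
  refine ⟨-Real.log q / Real.log 6, div_pos (neg_pos.2 (Real.log_neg hq0 hq1)) hl6,
    fun n hn => ?_⟩
  set α := -Real.log q / Real.log 6 with hα
  have hα0 : 0 < α := div_pos (neg_pos.2 (Real.log_neg hq0 hq1)) hl6
  have hqα : q = (6 : ℝ) ^ (-α) := by
    rw [Real.rpow_def_of_pos (by norm_num), hα, neg_div, neg_neg, mul_div_cancel₀ _ hl6.ne',
      Real.exp_log hq0]
  obtain ⟨k, hk1, hk2⟩ : ∃ k : ℕ, 6 ^ k ≤ n ∧ n < 6 ^ (k + 1) :=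
    ⟨Nat.log 6 n, Nat.pow_log_le_self 6 (by omega), Nat.lt_pow_succ_log_self (by norm_num) n⟩
  calc armProb half n ≤ armProb half (6 ^ k) :=
        armProb_anti half (by positivity) (by exact_mod_cast hk1)
    _ ≤ q ^ (k + 1) := hq k
    _ = ((6 : ℝ) ^ (k + 1)) ^ (-α) := by
        rw [hqα, ← Real.rpow_natCast, ← Real.rpow_mul (by norm_num), mul_comm,
          Real.rpow_mul (by norm_num), Real.rpow_natCast]
    _ ≤ (n : ℝ) ^ (-α) := Real.rpow_le_rpow_of_nonpos (by exact_mod_cast hn)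
        (by exact_mod_cast hk2.le) (by linarith)

/-! ### The expected boundary flux of a finite set -/

/-- The edges with exactly one endpoint in `S`. -/
def edgeBdry (S : Set (ℤ × ℤ)) : Set Edge := {e | ¬ (src e ∈ S ↔ tgt e ∈ S)}

theorem finite_edgeBdry (hS : S.Finite) : (edgeBdry S).Finite := by
  refine (hS.biUnion fun z _ => Set.toFinite
    {(z, false), ((z.1 - 1, z.2), false), (z, true), ((z.1, z.2 - 1), true)}).subset fun e he => ?_
  simp only [Set.mem_iUnion, Set.mem_insert_iff, Set.mem_singleton_iff]
  simp only [edgeBdry, Set.mem_ofPred_eq] at he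
  by_cases h : src e ∈ S
  · exact ⟨src e, h, eq_of_incident (Or.inl rfl)⟩
  · exact ⟨tgt e, by tauto, eq_of_incident (Or.inr rfl)⟩

/-- The origin is connected inside `S` to an endpoint of `e` that lies in `S`. -/
def ArrivesAt (S : Set (ℤ × ℤ)) (e : Edge) (O : Set Edge) : Prop :=
  ∃ x ∈ S, (src e = x ∨ tgt e = x) ∧ Conn (O ∩ inside S) 0 x

theorem increasingOn_arrivesAt (S : Set (ℤ × ℤ)) (e : Edge) :
    IncreasingOn (ArrivesAt S e) (inside S) := by
  rintro O O' ⟨x, hx, hx', h⟩ hO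
  exact ⟨x, hx, hx', increasingOn_conn h hO⟩

/-- The expected number of boundary edges of `S` whose inner endpoint is connected to the origin
inside `S`. -/
noncomputable def flux (p : I) (S : Set (ℤ × ℤ)) : ℝ :=
  ∑ᶠ e ∈ edgeBdry S, (bern Edge p).real {ω | ArrivesAt S e (opn ω)}

theorem flux_eq_sum (p : I) (hS : S.Finite) : flux p S =
    ∑ e ∈ (finite_edgeBdry hS).toFinset, (bern Edge p).real {ω | ArrivesAt S e (opn ω)} :=
  finsum_mem_eq_finite_toFinset_sum _ _

theorem flux_nonneg (p : I) (hS : S.Finite) : 0 ≤ flux p S := by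
  rw [flux_eq_sum p hS]
  exact Finset.sum_nonneg fun _ _ => measureReal_nonneg

theorem flux_mono {p q : I} (hpq : p ≤ q) (hS : S.Finite) : flux p S ≤ flux q S := by
  rw [flux_eq_sum p hS, flux_eq_sum q hS]
  exact Finset.sum_le_sum fun e _ => bern_real_mono (finite_inside hS)
    (increasingOn_arrivesAt S e).dependsOn (increasingOn_arrivesAt S e).isUpperSet hpq

theorem dependsOn_reach (S s : Set (ℤ × ℤ)) :
    DependsOn (fun ω => reach (opn ω ∩ inside S) s) (inside S) := by
  intro ω ω' h
  have : opn ω ∩ inside S = opn ω' ∩ inside S := by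
    ext e
    exact and_congr_left fun he => by simp only [opn, Set.mem_ofPred_eq, h e he]
  simp only [this]

theorem dependsOn_reach_eq (S s t : Set (ℤ × ℤ)) :
    DependsOn (fun ω => reach (opn ω ∩ inside S) s = t)
      ({e | src e ∈ t ∨ tgt e ∈ t} ∩ inside S) := by
  have key : ∀ ω ω' : Edge → Bool, (∀ e ∈ {e | src e ∈ t ∨ tgt e ∈ t} ∩ inside S, ω e = ω' e) →
      reach (opn ω ∩ inside S) s = t → reach (opn ω' ∩ inside S) s = t := by
    intro ω ω' h ht
    rw [← ht]
    refine reach_congr fun e he => and_congr_left fun hin => ?_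
    rw [ht] at he
    simp only [opn, Set.mem_ofPred_eq, h e ⟨he, hin⟩]
  exact fun ω ω' h => propext ⟨key ω ω' h, key ω' ω fun e he => (h e he).symm⟩

/-- A path leaving `T` has a last edge out of `T`. -/
theorem exists_last_exit {T : Set (ℤ × ℤ)} (h : Conn O u v) (hu : u ∈ T) (hv : v ∉ T) :
    ∃ x ∈ T, ∃ y ∉ T, ∃ e ∈ O, ((src e = x ∧ tgt e = y) ∨ (src e = y ∧ tgt e = x)) ∧
      Conn (O ∩ inside Tᶜ) y v := by
  suffices key : (u ∉ T ∧ Conn (O ∩ inside Tᶜ) u v) ∨ ∃ x ∈ T, ∃ y ∉ T, ∃ e ∈ O,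
      ((src e = x ∧ tgt e = y) ∨ (src e = y ∧ tgt e = x)) ∧ Conn (O ∩ inside Tᶜ) y v by
    exact key.resolve_left fun h => h.1 hu
  clear hu
  induction h using Relation.ReflTransGen.head_induction_on with
  | refl => exact Or.inl ⟨hv, Conn.refl⟩
  | @head x y hs _ ih =>
    rcases ih with ⟨hy, hc⟩ | h
    · by_cases hx : x ∈ T
      · obtain ⟨e, he, hxy⟩ := hs
        exact Or.inr ⟨x, hx, y, hy, e, he, hxy, hc⟩
      · exact Or.inl ⟨hx, (hs.inside (S := Tᶜ) hx hy).conn.trans hc⟩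
    · exact Or.inr h

/-- The contribution of the boundary edge `e = {x, y}` to Simon's inequality: given the cluster
of the origin in `S`, the state of `e` and the arm from `y` avoiding this cluster are still
unexplored. -/
theorem prob_arrive_open_arm_le (p : I) (hS : S.Finite) {x y : ℤ × ℤ} (hx : x ∈ S) (hy : y ∉ S)
    (hxy : (src e = x ∧ tgt e = y) ∨ (src e = y ∧ tgt e = x)) (k : ℤ) :
    (bern Edge p).real {ω | x ∈ reach (opn ω ∩ inside S) {0} ∧ e ∈ opn ω ∧
      Arm y k (opn ω ∩ inside (reach (opn ω ∩ inside S) {0})ᶜ)} ≤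
      p * armProb p k * (bern Edge p).real {ω | x ∈ reach (opn ω ∩ inside S) {0}} := by
  obtain ⟨R, hRQ, hsum, hdec⟩ := bern_real_decouple (p := p)
    (fun ω => reach (opn ω ∩ inside S) {0}) (finite_inside hS) (dependsOn_reach S {0})
    (fun t => x ∈ t) (fun t => {e | src e ∈ t ∨ tgt e ∈ t}) (dependsOn_reach_eq S {0})
  have heS : e ∉ inside S := fun h => by
    rcases hxy with ⟨-, rfl⟩ | ⟨rfl, -⟩
    · exact hy h.2
    · exact hy h.1
  have iArm : ∀ t : Set (ℤ × ℤ), IncreasingOn (fun O => Arm y k (O ∩ inside tᶜ))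
      (inside tᶜ ∩ inside (ball y k)) := fun t O O' h hO =>
    increasingOn_arm y k h fun e he => ⟨hO ⟨he.1.1, he.1.2, he.2⟩, he.1.2⟩
  have iOpen : IncreasingOn (fun O => e ∈ O) {e} := fun O O' h hO => hO ⟨h, rfl⟩
  have hfin : ∀ t : Set (ℤ × ℤ), (inside tᶜ ∩ inside (ball y k)).Finite := fun t =>
    (finite_inside_ball y k).subset Set.inter_subset_right
  have hdec' := hdec
    (fun t => {ω | e ∈ opn ω} ∩ {ω | Arm y k (opn ω ∩ inside tᶜ)})
    (fun t => {e} ∪ (inside tᶜ ∩ inside (ball y k)))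
    (fun t _ => (Set.finite_singleton e).union (hfin t))
    (fun t _ => by
      refine Set.disjoint_left.2 fun e' he' => ?_
      rintro (rfl | h)
      · exact heS he'.2
      · rcases he'.1 with h' | h'
        · exact h.1.1 h'
        · exact h.1.2 h')
    (fun t _ => dependsOn_inter (iOpen.dependsOn.mono Set.subset_union_left)
      ((iArm t).dependsOn.mono Set.subset_union_right))
  have hlhs : {ω | x ∈ reach (opn ω ∩ inside S) {0} ∧ e ∈ opn ω ∧
      Arm y k (opn ω ∩ inside (reach (opn ω ∩ inside S) {0})ᶜ)} =
      {ω | x ∈ reach (opn ω ∩ inside S) {0} ∧ ω ∈ {ω | e ∈ opn ω} ∩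
        {ω' | Arm y k (opn ω' ∩ inside (reach (opn ω ∩ inside S) {0})ᶜ)}} := rfl
  rw [hlhs, hdec', hsum, Finset.mul_sum]
  refine Finset.sum_le_sum fun t ht => ?_
  rw [mul_comm]
  refine mul_le_mul_of_nonneg_right ?_ measureReal_nonneg
  have hxt : x ∈ t := hRQ t ht
  rw [bern_real_inter_of_disjoint (Set.finite_singleton e) (hfin t) ?_ iOpen.dependsOn
    (iArm t).dependsOn, prob_mem_opn]
  · refine mul_le_mul_of_nonneg_left ?_ p.2.1
    exact (measureReal_mono fun ω hω => increasingOn_arm y k hω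
      fun e he => he.1.1).trans (prob_arm_le p y k)
  · refine Set.disjoint_left.2 ?_
    rintro _ rfl h
    rcases hxy with ⟨rfl, -⟩ | ⟨-, rfl⟩
    · exact h.1.1 hxt
    · exact h.1.2 hxt

/-- Simon's inequality. -/
theorem armProb_le_flux (p : I) (h0 : 0 ∈ S) {L n : ℤ} (hS : S ⊆ ball 0 L) (hn : L + 1 ≤ n) :
    armProb p n ≤ p * flux p S * armProb p (n - (L + 1)) := by
  have hSf : S.Finite := (finite_rect _ _ _ _).subset hS
  have hends : ∀ e ∈ edgeBdry S, ∃ x ∈ S, ∃ y ∉ S,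
      (src e = x ∧ tgt e = y) ∨ (src e = y ∧ tgt e = x) := by
    intro e he
    simp only [edgeBdry, Set.mem_ofPred_eq] at he
    by_cases h : src e ∈ S
    · exact ⟨_, h, tgt e, by tauto, Or.inl ⟨rfl, rfl⟩⟩
    · exact ⟨tgt e, by tauto, src e, h, Or.inr ⟨rfl, rfl⟩⟩
  choose! X hX Y hY hXY using hends
  have hcover : {ω | Arm 0 n (opn ω)} ⊆ ⋃ e ∈ (finite_edgeBdry hSf).toFinset,
      {ω | X e ∈ reach (opn ω ∩ inside S) {0} ∧ e ∈ opn ω ∧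
        Arm (Y e) (n - (L + 1)) (opn ω ∩ inside (reach (opn ω ∩ inside S) {0})ᶜ)} := by
    rintro ω ⟨v, -, hv, hc⟩
    set T := reach (opn ω ∩ inside S) {0}
    have hTS : T ⊆ S := fun z hz => reach_inside_mem hz h0
    have hvT : v ∉ T := fun h => by
      have := hS (hTS h)
      simp only [mem_ball, Far] at *
      omega
    obtain ⟨x, hx, y, hy, e, he, hxy, hyv⟩ :=
      exists_last_exit (hc.mono Set.inter_subset_left) (subset_reach rfl : (0 : ℤ × ℤ) ∈ T) hvT
    have hyS : y ∉ S := fun hyS =>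
      hy (mem_reach_of_step hx (Step.inside ⟨e, he, hxy⟩ (hTS hx) hyS))
    have heB : e ∈ edgeBdry S := by
      have := hTS hx
      rcases hxy with ⟨rfl, rfl⟩ | ⟨rfl, rfl⟩ <;> simp only [edgeBdry, Set.mem_ofPred_eq] <;> tauto
    have hXe : X e = x ∧ Y e = y := by
      have h1 := hX e heB
      have h2 := hY e heB
      rcases hXY e heB with ⟨h3, h4⟩ | ⟨h3, h4⟩ <;> rcases hxy with ⟨h5, h6⟩ | ⟨h5, h6⟩
      · exact ⟨h3.symm.trans h5, h4.symm.trans h6⟩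
      · exact absurd (h3.symm.trans h5 ▸ h1) hyS
      · exact absurd (hTS (h3.symm.trans h5 ▸ hx)) h2
      · exact ⟨h4.symm.trans h6, h3.symm.trans h5⟩
    simp only [Set.mem_iUnion, Set.Finite.mem_toFinset, Set.mem_ofPred_eq]
    refine ⟨e, heB, hXe.1 ▸ hx, he, hXe.2 ▸ arm_of_conn (by omega) hyv ?_⟩
    have hyL : y ∈ ball 0 (L + 1) := by
      have hxL := hS (hTS hx)
      simp only [mem_ball] at hxL ⊢
      rcases step_iff.1 (⟨e, he, hxy⟩ : Step (opn ω) x y) with ⟨h, -⟩ | ⟨h, -⟩ | ⟨h, -⟩ | ⟨h, -⟩ <;>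
        rw [Prod.ext_iff] at h <;> simp only at h <;> omega
    simp only [mem_ball, Far] at *
    omega
  refine (measureReal_mono hcover (measure_ne_top _ _)).trans
    ((measureReal_biUnion_finset_le _ _).trans ?_)
  rw [flux_eq_sum p hSf, mul_right_comm, Finset.mul_sum]
  refine Finset.sum_le_sum fun e he => ?_
  have he' : e ∈ edgeBdry S := by simpa using he
  refine (prob_arrive_open_arm_le p hSf (hX e he') (hY e he') (hXY e he') _).trans ?_
  refine mul_le_mul_of_nonneg_left (measureReal_mono ?_) (mul_nonneg p.2.1 measureReal_nonneg)
  rintro ω ⟨z, rfl, hz⟩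
  exact ⟨X e, hX e he', by rcases hXY e he' with h | h <;> tauto, hz⟩

/-- At `p = 1/2` every finite set has flux at least `2`: otherwise Simon's inequality would give
exponential decay, against the lower bound on the one-arm probability. -/
theorem two_le_flux_half (hS : S.Finite) (h0 : 0 ∈ S) : 2 ≤ flux half S := by
  by_contra hlt
  push Not at hlt
  obtain ⟨L, hL0, hL⟩ : ∃ L : ℕ, 0 ≤ L ∧ S ⊆ ball 0 L := by
    obtain ⟨A, hA⟩ := (hS.image fun z => z.1.natAbs + z.2.natAbs).bddAbove
    refine ⟨A, Nat.zero_le _, fun z hz => ?_⟩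
    have : z.1.natAbs + z.2.natAbs ≤ A := hA ⟨z, hz, rfl⟩
    simp only [mem_ball, Prod.fst_zero, Prod.snd_zero]
    omega
  set ρ := (half : ℝ) * flux half S with hρ
  have hh : (half : ℝ) = 1 / 2 := rfl
  have hρ0 : 0 ≤ ρ := mul_nonneg half.2.1 (flux_nonneg half hS)
  have hρ1 : ρ < 1 := by rw [hρ, hh]; linarith
  have hdecay : ∀ k : ℕ, armProb half (k * (L + 1)) ≤ ρ ^ k := by
    intro k
    induction k with
    | zero =>
      have : armProb half 0 ≤ 1 := measureReal_le_one
      simpa using this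
    | succ k ih =>
      have h1 := armProb_le_flux half h0 hL (n := ((k + 1 : ℕ) : ℤ) * (L + 1)) (by
        push_cast
        nlinarith [mul_nonneg (Int.natCast_nonneg k) (Int.natCast_nonneg (L + 1))])
      rw [show ((k + 1 : ℕ) : ℤ) * (L + 1) - (L + 1) = k * (L + 1) by push_cast; ring] at h1
      rw [pow_succ']
      exact h1.trans (mul_le_mul_of_nonneg_left ih hρ0)
  have hlow : ∀ k : ℕ, 1 ≤ k → 1 / (2 * (L + 1)) ≤ k * ρ ^ k := by
    intro k hk
    have h1 := half_div_le_armProb (n := k * (L + 1)) (Nat.mul_pos hk (Nat.succ_pos L))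
    have h2 := hdecay k
    push_cast at h1
    have h3 := h1.trans h2
    have hk0 : (0 : ℝ) < k := by exact_mod_cast hk
    have hL1 : (0 : ℝ) < L + 1 := by positivity
    calc (1 : ℝ) / (2 * (L + 1)) = k * (1 / 2 * ((k : ℝ) * (L + 1))⁻¹) := by field_simp
      _ ≤ k * ρ ^ k := mul_le_mul_of_nonneg_left h3 hk0.le
  have ht := tendsto_self_mul_const_pow_of_lt_one hρ0 hρ1
  have := ge_of_tendsto ht (Filter.eventually_atTop.2 ⟨1, hlow⟩)
  have hpos : (0 : ℝ) < 1 / (2 * (L + 1)) := by positivity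
  linarith

/-! ### The differential inequality -/

/-- The boundary of the box of radius `n`. -/
def sphere (n : ℤ) : Set (ℤ × ℤ) := {v | v ∈ ball 0 n ∧ Far 0 n v}

theorem arm_iff_mem_reach {n : ℤ} : Arm 0 n O ↔ 0 ∈ reach (O ∩ inside (ball 0 n)) (sphere n) :=
  ⟨fun ⟨v, h1, h2, h3⟩ => ⟨v, ⟨h1, h2⟩, h3.symm⟩, fun ⟨v, h1, h3⟩ => ⟨v, h1.1, h1.2, h3.symm⟩⟩

/-- If the set `W` connected to the boundary of the box does not contain the origin, then every
boundary edge of the complement of `W` reached by the origin is pivotal. -/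
theorem mem_pivotal_of_arrivesAt {n : ℤ} {ω : Edge → Bool}
    (h0 : 0 ∉ reach (opn ω ∩ inside (ball 0 n)) (sphere n))
    (he : e ∈ edgeBdry (ball 0 n \ reach (opn ω ∩ inside (ball 0 n)) (sphere n)))
    (heB : e ∈ inside (ball 0 n))
    (hA : ArrivesAt (ball 0 n \ reach (opn ω ∩ inside (ball 0 n)) (sphere n)) e (opn ω)) :
    ω ∈ pivotal {ω | Arm 0 n (opn ω)} e := by
  set W := reach (opn ω ∩ inside (ball 0 n)) (sphere n) with hW
  obtain ⟨x, hx, hex, h0x⟩ := hA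
  rw [mem_pivotal]
  constructor
  · have hsub : opn ω ⊆ opn (Function.update ω e true) := fun e' he' => by
      by_cases h : e' = e
      · subst h; simp [opn]
      · simpa [opn, h] using he'
    have hmem : e ∈ opn (Function.update ω e true) := by simp [opn]
    obtain ⟨y, hy, hxy⟩ : ∃ y ∈ W, (src e = x ∧ tgt e = y) ∨ (src e = y ∧ tgt e = x) := by
      simp only [edgeBdry, Set.mem_ofPred_eq, Set.mem_sdiff] at he hx
      have h1 := heB.1
      have h2 := heB.2
      rcases hex with rfl | rfl
      · exact ⟨tgt e, by tauto, Or.inl ⟨rfl, rfl⟩⟩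
      · exact ⟨src e, by tauto, Or.inr ⟨rfl, rfl⟩⟩
    obtain ⟨v, hv, hvy⟩ := hy
    refine ⟨v, hv.1, hv.2, ?_⟩
    have s1 : Conn (opn (Function.update ω e true) ∩ inside (ball 0 n)) 0 x :=
      h0x.mono (Set.inter_subset_inter hsub (inside_mono Set.sdiff_subset))
    have s2 : Step (opn (Function.update ω e true) ∩ inside (ball 0 n)) x y :=
      ⟨e, ⟨hmem, heB⟩, hxy⟩
    have s3 : Conn (opn (Function.update ω e true) ∩ inside (ball 0 n)) y v :=
      (hvy.mono (Set.inter_subset_inter_left _ hsub)).symm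
    exact s1.trans (s2.conn.trans s3)
  · intro h
    have hsub : opn (Function.update ω e false) ⊆ opn ω := fun e' he' => by
      by_cases h : e' = e
      · subst h; simp [opn] at he'
      · simpa [opn, h] using he'
    exact h0 (arm_iff_mem_reach.1 (increasingOn_arm 0 n h (Set.inter_subset_left.trans hsub)))

/-- The expected number of pivotal edges for the one-arm event is at least the probability of the
complement of this event, if all fluxes are at least `1`. -/
theorem one_sub_armProb_le_sum_pivotal {p : I} (n : ℤ) (hn : 0 ≤ n)
    (hp : ∀ S : Set (ℤ × ℤ), S.Finite → 0 ∈ S → 1 ≤ flux p S) :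
    1 - armProb p n ≤ ∑ e ∈ (finite_inside_ball 0 n).toFinset,
      (bern Edge p).real (pivotal {ω | Arm 0 n (opn ω)} e) := by
  obtain ⟨R, hRQ, hsum, hdec⟩ := bern_real_decouple (p := p)
    (fun ω => reach (opn ω ∩ inside (ball 0 n)) (sphere n)) (finite_inside_ball 0 n)
    (dependsOn_reach (ball 0 n) (sphere n)) (fun W => 0 ∉ W ∧ sphere n ⊆ W)
    (fun W => {e | src e ∈ W ∨ tgt e ∈ W}) (dependsOn_reach_eq (ball 0 n) (sphere n))
  have hball : ∀ W : Set (ℤ × ℤ), (ball 0 n \ W).Finite := fun W =>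
    (finite_rect _ _ _ _).subset Set.sdiff_subset
  have hbd : ∀ W : Set (ℤ × ℤ), sphere n ⊆ W → edgeBdry (ball 0 n \ W) ⊆ inside (ball 0 n) := by
    intro W hW e he
    have hinner : ∀ z ∈ ball 0 n \ W, ¬ Far 0 n z := fun z hz h => hz.2 (hW ⟨hz.1, h⟩)
    have h1 : src e ∈ ball 0 n \ W ∨ tgt e ∈ ball 0 n \ W := by
      simp only [edgeBdry, Set.mem_ofPred_eq] at he; tauto
    rcases h1 with h | h <;> have := hinner _ h <;> have := h.1 <;>
      obtain ⟨⟨x, y⟩, _ | _⟩ := e <;>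
      simp only [Far, inside, mem_ball, Set.mem_ofPred_eq, src_mk, tgt_true, tgt_false] at * <;>
      omega
  have hpiv : ∀ e ∈ inside (ball 0 n), ∑ W ∈ R, (bern Edge p).real
      {ω | reach (opn ω ∩ inside (ball 0 n)) (sphere n) = W} *
        (bern Edge p).real {ω | e ∈ edgeBdry (ball 0 n \ W) ∧ ArrivesAt (ball 0 n \ W) e (opn ω)} ≤
      (bern Edge p).real (pivotal {ω | Arm 0 n (opn ω)} e) := by
    intro e heB
    have h := hdec
      (fun W => {ω | e ∈ edgeBdry (ball 0 n \ W) ∧ ArrivesAt (ball 0 n \ W) e (opn ω)})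
      (fun W => inside (ball 0 n \ W)) (fun W _ => finite_inside (hball W))
      (fun W _ => Set.disjoint_left.2 fun e he he' => by
        rcases he.1 with h | h
        · exact he'.1.2 h
        · exact he'.2.2 h)
      (fun W _ => IncreasingOn.dependsOn
        (P := fun O => e ∈ edgeBdry (ball 0 n \ W) ∧ ArrivesAt (ball 0 n \ W) e O)
        fun O O' h hO => ⟨h.1, increasingOn_arrivesAt _ _ h.2 hO⟩)
    rw [← h]
    exact measureReal_mono fun ω hω => mem_pivotal_of_arrivesAt hω.1.1 hω.2.1 heB hω.2.2
  have hcompl : 1 - armProb p n = (bern Edge p).real {ω |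
      0 ∉ reach (opn ω ∩ inside (ball 0 n)) (sphere n) ∧
      sphere n ⊆ reach (opn ω ∩ inside (ball 0 n)) (sphere n)} := by
    have hm : MeasurableSet {ω | Arm 0 n (opn ω)} :=
      measurableSet_of_dependsOn (finite_inside_ball 0 n) (increasingOn_arm 0 n).dependsOn
    rw [armProb, ← probReal_compl_eq_one_sub hm]
    congr 1
    ext ω
    simp only [Set.mem_compl_iff, Set.mem_ofPred_eq, arm_iff_mem_reach, subset_reach, and_true]
  rw [hcompl, hsum]
  calc _ ≤ ∑ W ∈ R, ∑ e ∈ (finite_inside_ball 0 n).toFinset, (bern Edge p).real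
          {ω | reach (opn ω ∩ inside (ball 0 n)) (sphere n) = W} *
        (bern Edge p).real
          {ω | e ∈ edgeBdry (ball 0 n \ W) ∧ ArrivesAt (ball 0 n \ W) e (opn ω)} := by
        refine Finset.sum_le_sum fun W hW => ?_
        rw [← Finset.mul_sum]
        refine le_mul_of_one_le_right measureReal_nonneg ?_
        obtain ⟨h0, hsph⟩ := hRQ W hW
        have h0' : (0 : ℤ × ℤ) ∈ ball 0 n \ W := ⟨by simp [hn], h0⟩
        refine (hp _ (hball W) h0').trans ?_
        rw [flux_eq_sum p (hball W)]
        refine (Finset.sum_le_sum fun e he => measureReal_mono fun ω hω => ?_).trans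
          (Finset.sum_le_sum_of_subset_of_nonneg (Set.Finite.toFinset_subset_toFinset.2
            (hbd W hsph)) fun _ _ _ => measureReal_nonneg)
        exact ⟨by simpa using he, hω⟩
    _ = ∑ e ∈ (finite_inside_ball 0 n).toFinset, ∑ W ∈ R, (bern Edge p).real
          {ω | reach (opn ω ∩ inside (ball 0 n)) (sphere n) = W} *
        (bern Edge p).real
          {ω | e ∈ edgeBdry (ball 0 n \ W) ∧ ArrivesAt (ball 0 n \ W) e (opn ω)} :=
        Finset.sum_comm
    _ ≤ _ := Finset.sum_le_sum fun e he => hpiv e (by simpa using he)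

/-- Integrating the differential inequality from `1/2` to `p`. -/
theorem one_sub_exp_le_armProb {p : I} (hp : half ≤ p) (n : ℤ) (hn : 0 ≤ n) :
    1 - Real.exp (1 / 2 - p) ≤ armProb p n := by
  have hA := (increasingOn_arm 0 n).dependsOn
  rw [← (finite_inside_ball 0 n).coe_toFinset] at hA
  obtain ⟨f, hf, hfd, hf'⟩ := russo hA (increasingOn_arm 0 n).isUpperSet
  have hder : ∀ q : I, half ≤ q → 1 - f q ≤ deriv f q := by
    intro q hq
    rw [hf, hf']
    refine one_sub_armProb_le_sum_pivotal n hn fun S hS h0 => ?_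
    have := (two_le_flux_half hS h0).trans (flux_mono hq hS)
    linarith
  have hanti : AntitoneOn (fun x => (1 - f x) * Real.exp x) (Set.Icc (1 / 2 : ℝ) 1) := by
    have hd : ∀ x, HasDerivAt (fun x => (1 - f x) * Real.exp x)
        ((-deriv f x) * Real.exp x + (1 - f x) * Real.exp x) x := fun x =>
      ((hfd x).hasDerivAt.const_sub 1).mul (Real.hasDerivAt_exp x)
    refine antitoneOn_of_deriv_nonpos (convex_Icc _ _)
      (fun x _ => (hd x).continuousAt.continuousWithinAt)
      (fun x _ => (hd x).differentiableAt.differentiableWithinAt) fun x hx => ?_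
    rw [interior_Icc] at hx
    rw [(hd x).deriv, ← add_mul]
    have hx' := hder ⟨x, by linarith [hx.1], hx.2.le⟩ hx.1.le
    simp only at hx'
    exact mul_nonpos_of_nonpos_of_nonneg (by linarith) (Real.exp_pos x).le
  have hp' : (1 / 2 : ℝ) ≤ p := hp
  have h1 := hanti ⟨le_rfl, by norm_num⟩ ⟨hp', p.2.2⟩ hp'
  simp only at h1
  have hhalf : (1 / 2 : ℝ) = (half : ℝ) := rfl
  have h2 : 0 ≤ f (1 / 2) := by
    rw [hhalf, hf]; exact measureReal_nonneg
  have h3 : (1 - f p) * Real.exp p ≤ Real.exp (1 / 2) := by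
    refine h1.trans ?_
    have := Real.exp_pos (1 / 2)
    nlinarith
  have h4 : 1 - f p ≤ Real.exp (1 / 2 - p) := by
    rw [Real.exp_sub, le_div_iff₀ (Real.exp_pos _)]
    exact h3
  have h5 : f p = armProb p n := hf p
  linarith

/-! ### Transport to the edge set of the square lattice -/

theorem adj_src_tgt (e : Edge) : squareLattice.Adj (src e) (tgt e) := by
  obtain ⟨⟨x, y⟩, _ | _⟩ := e <;> simp [squareLattice]

/-- The edges of the square lattice, as unordered pairs of vertices. -/
noncomputable def edgeEquiv : Edge ≃ squareLattice.edgeSet :=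
  Equiv.ofBijective (fun e => ⟨s(src e, tgt e), adj_src_tgt e⟩) <| by
    constructor
    · rintro ⟨⟨x, y⟩, _ | _⟩ ⟨⟨x', y'⟩, _ | _⟩ h <;>
        simp only [Subtype.mk.injEq, Sym2.eq_iff, src_mk, tgt_true, tgt_false, Prod.mk.injEq,
          and_true, and_false, Bool.false_eq_true, Bool.true_eq_false] at h ⊢ <;> omega
    · rintro ⟨z, hz⟩
      induction z using Sym2.ind with
      | _ u v =>
        have h : |u.1 - v.1| + |u.2 - v.2| = 1 := hz
        have hcases : v = (u.1 + 1, u.2) ∨ u = (v.1 + 1, v.2) ∨ v = (u.1, u.2 + 1) ∨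
            u = (v.1, v.2 + 1) := by
          simp only [Prod.ext_iff]
          rcases abs_cases (u.1 - v.1) with h1 | h1 <;> rcases abs_cases (u.2 - v.2) with h2 | h2 <;>
            omega
        rcases hcases with h | h | h | h
        · exact ⟨(u, false), Subtype.ext (by simp [← h])⟩
        · exact ⟨(v, false), Subtype.ext (by simp [← h, Sym2.eq_swap])⟩
        · exact ⟨(u, true), Subtype.ext (by simp [← h])⟩
        · exact ⟨(v, true), Subtype.ext (by simp [← h, Sym2.eq_swap])⟩

theorem adj_openGraph_iff (ω : Config squareLattice) :
    (openGraph ω).Adj u v ↔ Step (opn fun e => ω (edgeEquiv e)) u v := by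
  constructor
  · rintro ⟨h, hω⟩
    refine ⟨edgeEquiv.symm ⟨s(u, v), h⟩, by simpa [opn] using hω, ?_⟩
    have h1 : s(src (edgeEquiv.symm ⟨s(u, v), h⟩), tgt (edgeEquiv.symm ⟨s(u, v), h⟩)) = s(u, v) :=
      congrArg Subtype.val (edgeEquiv.apply_symm_apply ⟨s(u, v), h⟩)
    rcases Sym2.eq_iff.1 h1 with h | h
    · exact Or.inl h
    · exact Or.inr h
  · rintro ⟨e, he, ⟨rfl, rfl⟩ | ⟨rfl, rfl⟩⟩
    · exact ⟨adj_src_tgt e, he⟩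
    · exact SimpleGraph.Adj.symm ⟨adj_src_tgt e, he⟩

theorem reachable_openGraph_iff (ω : Config squareLattice) :
    (openGraph ω).Reachable u v ↔ Conn (opn fun e => ω (edgeEquiv e)) u v := by
  rw [SimpleGraph.reachable_iff_reflTransGen]
  have : (openGraph ω).Adj = Step (opn fun e => ω (edgeEquiv e)) := by
    ext u v
    exact adj_openGraph_iff ω
  rw [this]
  rfl

theorem law_real (p : I) (P : Set Edge → Prop) :
    (law squareLattice p).real {ω | P (opn fun e => ω (edgeEquiv e))} =
      (bern Edge p).real {ω | P (opn ω)} :=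
  bern_real_relabel p edgeEquiv fun ω => P (opn ω)

theorem mem_boxBoundary_iff (n : ℕ) (v : ℤ × ℤ) : v ∈ boxBoundary n ↔ v ∈ sphere n := by
  have hbox : ∀ z, z ∈ box n ↔ z ∈ ball 0 n := fun z => by
    simp only [box, Set.mem_ofPred_eq, abs_le, mem_ball, Prod.fst_zero, Prod.snd_zero]
    omega
  simp only [boxBoundary, sphere, Set.mem_ofPred_eq, hbox]
  refine and_congr_right fun hv => ⟨?_, fun h => ?_⟩
  · rintro ⟨y, hy, hyn⟩
    have h : |v.1 - y.1| + |v.2 - y.2| = 1 := hy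
    simp only [mem_ball, Far, Prod.fst_zero, Prod.snd_zero] at *
    rcases abs_cases (v.1 - y.1) with h1 | h1 <;> rcases abs_cases (v.2 - y.2) with h2 | h2 <;>
      omega
  · simp only [Far, Prod.fst_zero, Prod.snd_zero] at h
    rcases h with h | h | h | h
    · exact ⟨(v.1 - 1, v.2), by simp [squareLattice], by simp only [mem_ball, Prod.fst_zero]; omega⟩
    · exact ⟨(v.1 + 1, v.2), by simp [squareLattice], by simp only [mem_ball, Prod.fst_zero]; omega⟩
    · exact ⟨(v.1, v.2 - 1), by simp [squareLattice], by simp only [mem_ball, Prod.snd_zero]; omega⟩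
    · exact ⟨(v.1, v.2 + 1), by simp [squareLattice], by simp only [mem_ball, Prod.snd_zero]; omega⟩

theorem oneArm_eq (p : I) (n : ℕ) : oneArm p n = armProb p n := by
  rw [armProb, ← law_real p (Arm 0 n), oneArm]
  congr 1
  ext ω
  simp only [ConnectedTo, Set.mem_ofPred_eq, mem_boxBoundary_iff, reachable_openGraph_iff]
  constructor
  · rintro ⟨v, hv, hc⟩
    exact arm_of_conn (by omega) hc hv.2
  · rintro ⟨v, hv, hv', hc⟩
    exact ⟨v, ⟨hv, hv'⟩, hc.mono Set.inter_subset_left⟩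

theorem infinite_cluster_iff (O : Set Edge) :
    {v | Conn O 0 v}.Infinite ↔ ∀ n : ℕ, Arm 0 n O := by
  constructor
  · intro h n
    obtain ⟨v, hv, hvn⟩ := h.exists_notMem_finite (finite_rect (0 - n) (0 + n) (0 - n) (0 + n))
    refine arm_of_conn (by omega) hv ?_
    simp only [mem_rect, Far, Prod.fst_zero, Prod.snd_zero] at *
    omega
  · intro h hfin
    obtain ⟨A, hA⟩ := (hfin.image fun z => z.1.natAbs + z.2.natAbs).bddAbove
    obtain ⟨v, -, hv, hc⟩ := h (A + 1)
    have : v.1.natAbs + v.2.natAbs ≤ A := hA ⟨v, hc.mono Set.inter_subset_left, rfl⟩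
    simp only [Far, Prod.fst_zero, Prod.snd_zero] at hv
    omega

theorem theta_eq (p : I) : theta p = (bern Edge p).real {ω | ∀ n : ℕ, Arm 0 n (opn ω)} := by
  rw [← law_real p fun O => ∀ n : ℕ, Arm 0 n O, theta]
  congr 1
  ext ω
  simp only [cluster, Set.mem_ofPred_eq, reachable_openGraph_iff, infinite_cluster_iff]

theorem theta_half : theta half = 0 := by
  obtain ⟨α, hα, h⟩ := exists_armProb_le_rpow
  have hle : ∀ n : ℕ, 1 ≤ n → theta half ≤ (n : ℝ) ^ (-α) := fun n hn => by
    rw [theta_eq]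
    have hsub : {ω | ∀ n : ℕ, Arm 0 n (opn ω)} ⊆ {ω | Arm 0 n (opn ω)} := fun ω hω => hω n
    exact (measureReal_mono hsub).trans (h n hn)
  have ht : Filter.Tendsto (fun n : ℕ => (n : ℝ) ^ (-α)) Filter.atTop (nhds 0) :=
    (tendsto_rpow_neg_atTop hα).comp tendsto_natCast_atTop_atTop
  exact le_antisymm (ge_of_tendsto ht (Filter.eventually_atTop.2 ⟨1, hle⟩)) measureReal_nonneg

theorem theta_pos_of_half_lt {p : I} (hp : half < p) : 0 < theta p := by
  have hanti : Antitone fun n : ℕ => {ω | Arm 0 n (opn ω)} := fun m n hmn ω hω =>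
    Arm.mono (by omega) (by exact_mod_cast hmn) hω
  have ht := tendsto_measure_iInter_atTop (μ := bern Edge p)
    (fun n : ℕ => (measurableSet_of_dependsOn (finite_inside_ball 0 n)
      (increasingOn_arm 0 n).dependsOn).nullMeasurableSet) hanti ⟨0, measure_ne_top _ _⟩
  have ht' := (ENNReal.tendsto_toReal (measure_ne_top _ _)).comp ht
  have hInter : (⋂ n : ℕ, {ω | Arm 0 n (opn ω)}) = {ω | ∀ n : ℕ, Arm 0 n (opn ω)} := by
    ext; simp
  rw [hInter] at ht'
  have hge := ge_of_tendsto ht' (Filter.Eventually.of_forall fun n : ℕ =>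
    one_sub_exp_le_armProb hp.le n (by omega))
  rw [theta_eq]
  have hp' : (1 / 2 : ℝ) < p := hp
  have : Real.exp (1 / 2 - p) < 1 := Real.exp_lt_one_iff.2 (by linarith)
  exact lt_of_lt_of_le (by linarith) hge

theorem criticalPoint_eq_half : criticalPoint = half := by
  apply le_antisymm
  · refine sSup_le fun p hp => ?_
    by_contra h
    exact (theta_pos_of_half_lt (not_le.1 h)).ne' hp.2.2
  · refine le_sSup ⟨?_, ?_, theta_half⟩
    · exact Subtype.coe_lt_coe.1 (by norm_num [half])
    · exact Subtype.coe_lt_coe.1 (by norm_num [half])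

end Percolation

theorem mainTheorem8 :
    Percolation.criticalPoint = Percolation.half ∧
    (∃ α : ℝ, 0 < α ∧ ∀ n : ℕ, 1 ≤ n →
      (1 / 2 : ℝ) * (n : ℝ)⁻¹ ≤ Percolation.oneArm Percolation.half n ∧
      Percolation.oneArm Percolation.half n ≤ (n : ℝ) ^ (-α)) ∧
    Percolation.theta Percolation.criticalPoint = 0 := by
  refine ⟨Percolation.criticalPoint_eq_half, ?_, ?_⟩
  · obtain ⟨α, hα, h⟩ := Percolation.exists_armProb_le_rpow
    refine ⟨α, hα, fun n hn => ?_⟩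
    rw [Percolation.oneArm_eq]
    exact ⟨Percolation.half_div_le_armProb hn, h n hn⟩
  · rw [Percolation.criticalPoint_eq_half, Percolation.theta_half]
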